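/- Two particles of equal mass $\mu>0$ move on the unit sphere $S\subset\mathbb R^3$ with Lagrangian $\tfrac12\mu|\dot{\mathbf x}_1|^2+\tfrac12\mu|\dot{\mathbf x}_2|^2-V(q)$, where $q\in(0,\pi)$ is the geodesic distance of the particles (coincident and antipodal positions are excluded) and $V$ is a smooth function on $(0,\pi)$ with $V'<0$ (repelling potential). A relative equilibrium (RE) is a motion $\mathbf x_j(t)=g(t)\mathbf x_j(0)$ with $g$ a one-parameter subgroup of $SO(3)$, i.e. a uniform rotation with some angular velocity vector $\Omega$. RE that differ by a rotation of the sphere, by time reversal, or by exchanging the two identical particles are not distinguished. Let $\theta_1,\theta_2\in[0,\pi/2]$ be the angles between the line spanned by $\Omega$ (the axis) and the two masses, and $\theta=\min(\theta_1,\theta_2)$. An RE is called isosceles if the axis is perpendicular to the radius through the midpoint of the masses, and right-angled if $q=\pi/2$. For every RE the axis lies in the plane of $\mathbf x_1,\mathbf x_2$ with both masses on the same side of it, $\theta_1,\theta_2\in(0,\pi/2)$, $q=\pi-(\theta_1+\theta_2)$, $\zeta:=\tfrac12\mu\sin2\theta_1=\tfrac12\mu\sin2\theta_2$, and $|\Omega|^2=-\zeta^{-1}V'(q)$.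 Every RE is isosceles or right-angled: 1. For every $q\in(0,\pi)$, $q\ne\pi/2$, there is a unique RE with separation $q$, and it is isosceles (here the exchange of the particles is not needed for uniqueness). 2. Every right-angled RE has $\theta\in(0,\pi/4]$, and for every $\theta\in(0,\pi/4]$ there is a unique right-angled RE with this $\theta$. An RE is both isosceles and right-angled if and only if $q=\pi/2$ and $\theta=\pi/4$. There the two families meet. In the reduced phase space (the quotient of the phase space by $SO(3)$, of dimension 5), near this point, the equilibria are exactly two smooth curves $\gamma,\delta$ crossing transversally, where $\gamma(s)$ is an isosceles RE with $q=\pi/2+s$ and $\delta(s)$ a right-angled RE with $\theta=\pi/4-|s|$; the symmetry given by exchange of the particles combined with a reflection of the sphere fixes the points of $\gamma$ and maps $\delta(s)$ to $\delta(-s)$; and the squared length $C$ of the angular momentum has a nondegenerate minimum along $\delta$ at $s=0$. With $C$ as bifurcation parameter this is a pitchfork bifurcation, i.e. moreover $\frac{d}{ds}C(\gamma(s))\ne0$ at $s=0$, if and only if $V''(\pi/2)\ne2V'(\pi/2)$. For $V(q)=\cot q$ consider the linearization of the reduced equations of motion at an RE, restricted to the level set of $C$ (the symplectic leaf). The isosceles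 RE with $q\in(0,\pi/2)$ are linearly unstable (there is an eigenvalue with positive real part), while the isosceles RE with $q\in(\pi/2,\pi)$ and the right-angled RE with $\theta\ne\pi/4$ are elliptic (the linearization is diagonalizable over $\mathbb C$ with all eigenvalues purely imaginary and nonzero). -/

import Mathlib

open Real Set Filter Topology Matrix
open scoped ContDiff

noncomputable section

namespace SphereTwoBody

/-! ### Two particles on the unit sphere -/

/-- Vectors of `ℝ³`, with the dot product `⬝ᵥ` and the cross product `⨯₃`. -/
abbrev Vec3 := Fin 3 → ℝ

/-- Geodesic distance on the unit sphere: the `q ∈ [0, π]` with `cos q = x ⬝ᵥ y`. -/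
def separation (x y : Vec3) : ℝ := Real.arccos (x ⬝ᵥ y)

/-- Two points of the unit sphere that are neither equal nor antipodal. -/
def IsConfiguration (x y : Vec3) : Prop :=
  x ⬝ᵥ x = 1 ∧ y ⬝ᵥ y = 1 ∧ x ≠ y ∧ x ≠ -y

/-- Motions of two particles of masses `μ₁`, `μ₂` on the unit sphere with potential energy `V(q)`,
`q` the geodesic distance: for every tangent direction `w`, mass times acceleration along `w` is
minus the derivative of the potential energy along `w` (the Euler-Lagrange equations of
`½ μ₁ |x₁'|² + ½ μ₂ |x₂'|² - V(q)` on the product of two spheres). -/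
def IsMotion (μ₁ μ₂ : ℝ) (V : ℝ → ℝ) (x₁ x₂ : ℝ → Vec3) : Prop :=
  ContDiff ℝ ∞ x₁ ∧ ContDiff ℝ ∞ x₂ ∧ ∀ t : ℝ,
    IsConfiguration (x₁ t) (x₂ t) ∧
    (∀ w : Vec3, w ⬝ᵥ x₁ t = 0 →
      μ₁ * (w ⬝ᵥ deriv (deriv x₁) t) =
        -lineDeriv ℝ (fun y => V (separation y (x₂ t))) (x₁ t) w) ∧
    (∀ w : Vec3, w ⬝ᵥ x₂ t = 0 →
      μ₂ * (w ⬝ᵥ deriv (deriv x₂) t) =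
        -lineDeriv ℝ (fun y => V (separation (x₁ t) y)) (x₂ t) w)

/-! ### Relative equilibria -/

/-- The matrix of `x ↦ Ω ⨯₃ x`; these are exactly the elements of the Lie algebra `so(3)`. -/
def crossMatrix (Ω : Vec3) : Matrix (Fin 3) (Fin 3) ℝ :=
  !![0, -Ω 2, Ω 1; Ω 2, 0, -Ω 0; -Ω 1, Ω 0, 0]

/-- The one-parameter subgroup of `SO(3)` with angular velocity vector `Ω`. -/
def rot (Ω : Vec3) (t : ℝ) : Matrix (Fin 3) (Fin 3) ℝ :=
  NormedSpace.exp (t • crossMatrix Ω)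

/-- Initial positions of two particles, and an angular velocity vector. -/
structure Rotation where
  x₁ : Vec3
  x₂ : Vec3
  Ω : Vec3

/-- Relative equilibrium: a motion of the form `xⱼ(t) = g(t) xⱼ(0)` with `g` a one-parameter
subgroup of `SO(3)`. -/
def IsRE (μ₁ μ₂ : ℝ) (V : ℝ → ℝ) (d : Rotation) : Prop :=
  IsMotion μ₁ μ₂ V (fun t => rot d.Ω t *ᵥ d.x₁) (fun t => rot d.Ω t *ᵥ d.x₂)

/-- The angular separation of the masses. -/
def Rotation.q (d : Rotation) : ℝ := separation d.x₁ d.x₂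

/-- The angle in `[0, π/2]` between the line spanned by `Ω` and the unit vector `x`. -/
def axisAngle (Ω x : Vec3) : ℝ := Real.arccos (|Ω ⬝ᵥ x| / √(Ω ⬝ᵥ Ω))

/-- Angle between the axis of rotation and the first mass. -/
def Rotation.θ₁ (d : Rotation) : ℝ := axisAngle d.Ω d.x₁

/-- Angle between the axis of rotation and the second mass. -/
def Rotation.θ₂ (d : Rotation) : ℝ := axisAngle d.Ω d.x₂

/-- The smaller of the angles between the axis of rotation and the masses. -/
def Rotation.θ (d : Rotation) : ℝ := min d.θ₁ d.θ₂

/-- The axis lies in the plane of the two masses, and in that plane both masses lie on the same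
side of the axis. -/
def Rotation.SameSide (d : Rotation) : Prop :=
  ∃ a b : ℝ, a * b < 0 ∧ d.Ω = a • d.x₁ + b • d.x₂

/-- The two particles exchanged. -/
def Rotation.swap (d : Rotation) : Rotation := ⟨d.x₂, d.x₁, d.Ω⟩

/-- `d` and `d'` agree up to a rotation of the sphere and, possibly, time reversal. -/
def RotCongruent (d d' : Rotation) : Prop :=
  ∃ R ∈ Matrix.specialOrthogonalGroup (Fin 3) ℝ,
    d'.x₁ = R *ᵥ d.x₁ ∧ d'.x₂ = R *ᵥ d.x₂ ∧ (d'.Ω = R *ᵥ d.Ω ∨ d'.Ω = -(R *ᵥ d.Ω))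

/-- Isosceles relative equilibria of two equal masses `μ`: the axis of rotation is perpendicular to
the radius that passes midway between the masses. -/
def IsIsoscelesRE (μ : ℝ) (V : ℝ → ℝ) (d : Rotation) : Prop :=
  IsRE μ μ V d ∧ d.Ω ⬝ᵥ (d.x₁ + d.x₂) = 0

/-- Right-angled relative equilibria of two equal masses `μ`. -/
def IsRightAngledRE (μ : ℝ) (V : ℝ → ℝ) (d : Rotation) : Prop :=
  IsRE μ μ V d ∧ d.q = π / 2

/-! ### The reduced system

The quotient of the phase space by `SO(3)` is five-dimensional, with coordinates
`(q, p, m₁, m₂, m₃)`: the separation, its conjugate momentum, and the angular momentum in the body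
frame `e₁ = x₁ × x₂ / sin q`, `e₂ = (x₂ - cos q x₁) / sin q`, `e₃ = -x₁`. -/

/-- Points `(q, p, m₁, m₂, m₃)` of the reduced phase space (where `0 < q < π`). -/
abbrev Red := Fin 5 → ℝ

/-- Partial derivatives on the reduced phase space. -/
def pd (i : Fin 5) (F : Red → ℝ) (z : Red) : ℝ := lineDeriv ℝ F z (Pi.single i 1)

/-- The reduced Hamiltonian. -/
def redH (μ₁ μ₂ : ℝ) (V : ℝ → ℝ) (z : Red) : ℝ :=
  ((μ₁ + μ₂) * z 1 ^ 2 - 2 * μ₂ * z 1 * z 2 + μ₂ * z 2 ^ 2 + μ₂ * z 3 ^ 2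
    - 2 * μ₂ * (cos (z 0) / sin (z 0)) * z 3 * z 4
    + (μ₁ + μ₂ * cos (z 0) ^ 2) / sin (z 0) ^ 2 * z 4 ^ 2) / (2 * μ₁ * μ₂) + V (z 0)

/-- The reduced equations of motion `q' = H_p`, `p' = -H_q`, `m' = m × H_m`. -/
def redField (μ₁ μ₂ : ℝ) (V : ℝ → ℝ) (z : Red) : Red :=
  let H := redH μ₁ μ₂ V
  let m' : Vec3 := ![z 2, z 3, z 4] ⨯₃ ![pd 2 H z, pd 3 H z, pd 4 H z]
  ![pd 1 H z, -pd 0 H z, m' 0, m' 1, m' 2]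

/-- The Casimir function: the square of the length of the angular momentum. Its level sets
(where it is positive) are the symplectic leaves of the reduced phase space. -/
def casimir (z : Red) : ℝ := z 2 ^ 2 + z 3 ^ 2 + z 4 ^ 2

/-- The reduction map on positions `x₁, x₂` and velocities `v₁, v₂`. -/
def reduce (μ₁ μ₂ : ℝ) (x₁ x₂ v₁ v₂ : Vec3) : Red :=
  let S := sin (separation x₁ x₂)
  let C := cos (separation x₁ x₂)
  let J : Vec3 := μ₁ • (x₁ ⨯₃ v₁) + μ₂ • (x₂ ⨯₃ v₂)
  ![separation x₁ x₂, μ₂ * (v₂ ⬝ᵥ (C • x₂ - x₁)) / S,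
    (J ⬝ᵥ (x₁ ⨯₃ x₂)) / S, (J ⬝ᵥ (x₂ - C • x₁)) / S, -(J ⬝ᵥ x₁)]

/-- The point of the reduced phase space given by a pair of particles rotating with angular
velocity vector `Ω`. -/
def Rotation.reduced (μ₁ μ₂ : ℝ) (d : Rotation) : Red :=
  reduce μ₁ μ₂ d.x₁ d.x₂ (d.Ω ⨯₃ d.x₁) (d.Ω ⨯₃ d.x₂)

/-- For equal masses: exchange of the two particles combined with a reflection of the sphere,
in the coordinates of the reduced phase space. -/
def mirrorSwap (z : Red) : Red :=
  ![z 0, z 1 - z 2, -z 2, cos (z 0) * z 3 + sin (z 0) * z 4, sin (z 0) * z 3 - cos (z 0) * z 4]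

/-! ### Linear stability -/

/-- The complexified linearization of the vector field `X` at `z`. -/
def linearization (X : Red → Red) (z : Red) : Matrix (Fin 5) (Fin 5) ℂ :=
  (LinearMap.toMatrix' (fderiv ℝ X z : Red →ₗ[ℝ] Red)).map Complex.ofReal

/-- Complexified tangent vectors at `z` to the level set of `C`. -/
def leafTangent (C : Red → ℝ) (z : Red) : Set (Fin 5 → ℂ) :=
  {w | ∑ i, (pd i C z : ℂ) * w i = 0}

/-- `w` is an eigenvector, with eigenvalue `l`, of the linearization of `X` at `z` restricted to
the level set of `C`. -/
def IsLeafEigenvector (X : Red → Red) (C : Red → ℝ) (z : Red) (l : ℂ) (w : Fin 5 → ℂ) : Prop :=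
  w ∈ leafTangent C z ∧ w ≠ 0 ∧ linearization X z *ᵥ w = l • w

/-- `z` is an equilibrium, and the linearization on the level set of `C` has an eigenvalue of
positive real part. -/
def IsUnstableRE (X : Red → Red) (C : Red → ℝ) (z : Red) : Prop :=
  X z = 0 ∧ ∃ l w, IsLeafEigenvector X C z l w ∧ 0 < l.re

/-- `z` is an equilibrium, and the linearization on the level set of `C` is diagonalizable over `ℂ`
with all its eigenvalues purely imaginary and nonzero. -/
def IsEllipticRE (X : Red → Red) (C : Red → ℝ) (z : Red) : Prop :=
  X z = 0 ∧
  (∀ l w, IsLeafEigenvector X C z l w → l.re = 0 ∧ l ≠ 0) ∧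
  ∀ w ∈ leafTangent C z, w ∈ Submodule.span ℂ {v | ∃ l, IsLeafEigenvector X C z l v}

/-! ### Pitchfork bifurcation -/

/-- The symmetric branch `γ` and the branch `δ` of equilibria of `X` cross at `γ 0 = δ 0`:
near this point `σ` is an involutive symmetry of the vector field `X` and of its first integral `C`;
`γ` consists of points fixed by `σ`, and `δ` is mapped to itself by `σ` with the sign of its
parameter reversed; the branches are smooth and transverse, and together they are all the
equilibria near the crossing; along `δ` the parameter `C` has a nondegenerate minimum. -/
def IsSymmetricCrossing (X : Red → Red) (C : Red → ℝ) (σ : Red → Red) (γ δ : ℝ → Red) : Prop :=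
  γ 0 = δ 0 ∧
  (∀ᶠ z in 𝓝 (γ 0), fderiv ℝ C z (X z) = 0 ∧
    σ (σ z) = z ∧ C (σ z) = C z ∧ X (σ z) = fderiv ℝ σ z (X z)) ∧
  (∃ ε > 0, ContDiffOn ℝ ∞ γ (Ioo (-ε) ε) ∧ ContDiffOn ℝ ∞ δ (Ioo (-ε) ε) ∧
    (∀ s ∈ Ioo (-ε) ε, σ (γ s) = γ s ∧ σ (δ s) = δ (-s)) ∧
    ∀ r ∈ Ioc 0 ε, ∀ᶠ z in 𝓝 (γ 0), X z = 0 ↔ z ∈ γ '' Ioo (-r) r ∪ δ '' Ioo (-r) r) ∧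
  LinearIndependent ℝ ![deriv γ 0, deriv δ 0] ∧
  deriv (fun s => C (δ s)) 0 = 0 ∧ 0 < iteratedDeriv 2 (fun s => C (δ s)) 0

/-- Pitchfork bifurcation with bifurcation parameter `C`: in addition `C` passes through its
critical value with nonzero speed along the symmetric branch, so that the branch `δ` gives two
further equilibria for `C` above the critical value, and none below it. -/
def IsPitchfork (X : Red → Red) (C : Red → ℝ) (σ : Red → Red) (γ δ : ℝ → Red) : Prop :=
  IsSymmetricCrossing X C σ γ δ ∧ deriv (fun s => C (γ s)) 0 ≠ 0

end SphereTwoBody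

end

open SphereTwoBody

namespace SphereTwoBody

/-! ### Vectors and rotations -/

/-! Rotations carry the equations of motion at time `0` to those at time `t`, so being an RE is a
pair of tangential force balances at time `0`. Each one makes the tangential part of `Ω` at one mass
proportional to that of the other mass, and repulsion keeps the factor nonzero. Hence `Ω = a x₁ + b
x₂`, and with `c = cos q` and `κ = V'(q) / (μ sin q) < 0` what remains is `(a + b c) b = κ = (a c +
b) a` (`isRE_iff`). The difference of the two equations is `c (b - a) (b + a) = 0`. The root `a = b`
would give `b² (1 + c) = κ < 0`, so either `c = 0` (right-angled) or `a = -b` (isosceles)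
(`IsBalanced.cos_eq_zero_or`). Angles, `|Ω|²` and uniqueness are read off from `(q, a, b)`, which
determines an RE up to rotation (`IsBalanced.rotCongruent`).

In reduced coordinates an RE has `p = m₁ = 0`. Near the crossing, where `m₂, m₃ > 0`, the zeros of
the explicit vector field split by a factorization into the same two families
(`redField_eq_zero_iff`). Along them the Casimir function is `-2μV'(π/2) / cos 2s` on the
right-angled branch and `-2μ V'(q) sin q (1 + cos q) / (1 - cos q)` on the isosceles one. The first
has a nondegenerate minimum at `s = 0`; the second has derivative `-2μ (V'' - 2V')` at `q = π/2`.

For stability, the linearization on the four-dimensional leaf is off-diagonal with `2 × 2` blocks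
`A`, `B` (`HasLeafBlocks`), so the squares of its eigenvalues are the eigenvalues of `A B`.
Ellipticity follows from `tr < 0 < det` and `4 det < tr²`; instability follows from an explicit
positive eigenvalue of `A B`. -/

theorem crossMatrix_mulVec (Ω x : Vec3) : crossMatrix Ω *ᵥ x = Ω ⨯₃ x := by
  ext i
  fin_cases i <;> simp only [mulVec, vec3_dotProduct, cross_apply] <;>
    simp [crossMatrix] <;> ring

theorem crossMatrix_transpose (Ω : Vec3) : (crossMatrix Ω)ᵀ = -crossMatrix Ω := by
  ext i j
  fin_cases i <;> fin_cases j <;> simp [crossMatrix]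

theorem dotProduct_cross_cross (w Ω x : Vec3) :
    w ⬝ᵥ (Ω ⨯₃ (Ω ⨯₃ x)) = (Ω ⬝ᵥ x) * (w ⬝ᵥ Ω) - (Ω ⬝ᵥ Ω) * (w ⬝ᵥ x) := by
  simp [cross_cross_eq_smul_sub_smul', dotProduct_sub, dotProduct_smul]

theorem cross_cross_dotProduct (x Ω w : Vec3) :
    (x ⨯₃ (Ω ⨯₃ x)) ⬝ᵥ w = (x ⬝ᵥ x) * (Ω ⬝ᵥ w) - (Ω ⬝ᵥ x) * (x ⬝ᵥ w) := by
  simp [cross_cross_eq_smul_sub_smul', sub_dotProduct, smul_dotProduct]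

theorem rot_transpose_mul (Ω : Vec3) (t : ℝ) : (rot Ω t)ᵀ * rot Ω t = 1 := by
  unfold rot
  rw [← Matrix.exp_transpose, transpose_smul, crossMatrix_transpose, smul_neg, Matrix.exp_neg]
  exact Matrix.nonsing_inv_mul _ ((Matrix.isUnit_iff_isUnit_det _).1 (Matrix.isUnit_exp _))

theorem rot_zero (Ω : Vec3) : rot Ω 0 = 1 := by
  simp [rot]

theorem dotProduct_mulVec_of_transpose_mul {R : Matrix (Fin 3) (Fin 3) ℝ} (hR : Rᵀ * R = 1)
    (x y : Vec3) : (R *ᵥ x) ⬝ᵥ (R *ᵥ y) = x ⬝ᵥ y := by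
  rw [dotProduct_mulVec, ← mulVec_transpose, mulVec_mulVec, hR, one_mulVec]

theorem exists_mulVec_eq_of_transpose_mul {R : Matrix (Fin 3) (Fin 3) ℝ} (hR : Rᵀ * R = 1)
    (w : Vec3) : ∃ w₀, R *ᵥ w₀ = w :=
  ⟨Rᵀ *ᵥ w, by rw [mulVec_mulVec, mul_eq_one_comm.1 hR, one_mulVec]⟩

theorem hasDerivAt_rot_mulVec (Ω x : Vec3) (t : ℝ) :
    HasDerivAt (fun t => rot Ω t *ᵥ x) (rot Ω t *ᵥ (Ω ⨯₃ x)) t := by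
  -- A Banach algebra norm is needed to differentiate `exp`; the choice is immaterial.
  let : NormedRing (Matrix (Fin 3) (Fin 3) ℝ) := Matrix.linftyOpNormedRing
  let : NormedAlgebra ℝ (Matrix (Fin 3) (Fin 3) ℝ) := Matrix.linftyOpNormedAlgebra
  have h : HasDerivAt (fun t => rot Ω t) (rot Ω t * crossMatrix Ω) t :=
    hasDerivAt_exp_smul_const (𝕂 := ℝ) (crossMatrix Ω) t
  let L : Matrix (Fin 3) (Fin 3) ℝ →ₗ[ℝ] Vec3 :=
    { toFun := fun M => M *ᵥ x
      map_add' := fun M N => add_mulVec M N x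
      map_smul' := fun c M => smul_mulVec c M x }
  have h2 := (LinearMap.toContinuousLinearMap L).hasFDerivAt.comp_hasDerivAt t h
  have e : rot Ω t *ᵥ (Ω ⨯₃ x) = (LinearMap.toContinuousLinearMap L) (rot Ω t * crossMatrix Ω) := by
    change _ = (rot Ω t * crossMatrix Ω) *ᵥ x
    rw [← mulVec_mulVec, crossMatrix_mulVec]
  rw [e]
  exact h2

theorem deriv_rot_mulVec (Ω x : Vec3) :
    deriv (fun t => rot Ω t *ᵥ x) = fun t => rot Ω t *ᵥ (Ω ⨯₃ x) :=
  funext fun t => (hasDerivAt_rot_mulVec Ω x t).deriv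

/-- The derivative of an orbit is the orbit of `Ω ⨯₃ x` under the same subgroup, so induction closes
once the starting vector is generalized. -/
theorem contDiff_rot_mulVec (Ω x : Vec3) : ContDiff ℝ ∞ (fun t => rot Ω t *ᵥ x) := by
  rw [contDiff_infty]
  intro n
  induction n generalizing x with
  | zero =>
    exact contDiff_zero.2 (continuous_iff_continuousAt.2 fun t =>
      (hasDerivAt_rot_mulVec Ω x t).continuousAt)
  | succ n ih =>
    push_cast
    rw [contDiff_succ_iff_deriv]
    refine ⟨fun t => (hasDerivAt_rot_mulVec Ω x t).differentiableAt, by simp, ?_⟩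
    rw [deriv_rot_mulVec]
    exact ih _

/-! ### Separation -/

theorem dotProduct_mem_of_isConfiguration {x y : Vec3} (h : IsConfiguration x y) :
    x ⬝ᵥ y ∈ Ioo (-1 : ℝ) 1 := by
  obtain ⟨hx, hy, h1, h2⟩ := h
  have e1 : 0 < (x - y) ⬝ᵥ (x - y) := by
    refine lt_of_le_of_ne ?_ fun h => h1 (sub_eq_zero.1 (dotProduct_self_eq_zero.1 h.symm))
    simp only [vec3_dotProduct]; nlinarith [sq_nonneg ((x - y) 0), sq_nonneg ((x - y) 1),
      sq_nonneg ((x - y) 2)]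
  have e2 : 0 < (x + y) ⬝ᵥ (x + y) := by
    refine lt_of_le_of_ne ?_ fun h =>
      h2 (eq_neg_of_add_eq_zero_left (dotProduct_self_eq_zero.1 h.symm))
    simp only [vec3_dotProduct]; nlinarith [sq_nonneg ((x + y) 0), sq_nonneg ((x + y) 1),
      sq_nonneg ((x + y) 2)]
  simp only [sub_dotProduct, add_dotProduct, dotProduct_sub, dotProduct_add, hx, hy,
    dotProduct_comm y x] at e1 e2
  constructor <;> linarith

theorem separation_comm (x y : Vec3) : separation x y = separation y x := by
  simp [separation, dotProduct_comm]

theorem cos_separation {x y : Vec3} (h : IsConfiguration x y) :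
    cos (separation x y) = x ⬝ᵥ y :=
  cos_arccos (dotProduct_mem_of_isConfiguration h).1.le (dotProduct_mem_of_isConfiguration h).2.le

theorem separation_mem {x y : Vec3} (h : IsConfiguration x y) : separation x y ∈ Ioo 0 π := by
  have := dotProduct_mem_of_isConfiguration h
  refine ⟨arccos_pos.2 this.2, lt_of_le_of_ne (arccos_le_pi _) fun h => ?_⟩
  have := arccos_eq_pi.1 h
  linarith [this, (dotProduct_mem_of_isConfiguration ‹_›).1]

theorem IsConfiguration.symm {x y : Vec3} (h : IsConfiguration x y) : IsConfiguration y x :=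
  ⟨h.2.1, h.1, h.2.2.1.symm, fun e => h.2.2.2 (by simp [e])⟩

theorem lineDeriv_potential {V : ℝ → ℝ} {x y : Vec3} (h : IsConfiguration x y)
    (hV : DifferentiableAt ℝ V (separation x y)) (w : Vec3) :
    lineDeriv ℝ (fun z => V (separation z y)) x w =
      -(deriv V (separation x y) / sin (separation x y) * (w ⬝ᵥ y)) := by
  have hc := dotProduct_mem_of_isConfiguration h
  have h1 : HasDerivAt (fun t : ℝ => (x + t • w) ⬝ᵥ y) (w ⬝ᵥ y) 0 := by
    simp only [add_dotProduct, smul_dotProduct, smul_eq_mul]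
    simpa using ((hasDerivAt_id (0 : ℝ)).mul_const (w ⬝ᵥ y)).const_add (x ⬝ᵥ y)
  have h2 := hasDerivAt_arccos hc.1.ne' hc.2.ne
  have h3 : HasDerivAt (fun t : ℝ => separation (x + t • w) y)
      (-(1 / √(1 - (x ⬝ᵥ y) ^ 2)) * (w ⬝ᵥ y)) 0 := by
    refine HasDerivAt.comp (h₂ := arccos) 0 ?_ h1
    simpa using h2
  have h4 : HasDerivAt (fun t : ℝ => V (separation (x + t • w) y))
      (deriv V (separation x y) * (-(1 / √(1 - (x ⬝ᵥ y) ^ 2)) * (w ⬝ᵥ y))) 0 := by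
    refine HasDerivAt.comp (h₂ := V) 0 ?_ h3
    simpa using hV.hasDerivAt
  rw [lineDeriv, h4.deriv, separation, sin_arccos]
  ring

theorem lineDeriv_potential_right {V : ℝ → ℝ} {x y : Vec3} (h : IsConfiguration x y)
    (hV : DifferentiableAt ℝ V (separation x y)) (w : Vec3) :
    lineDeriv ℝ (fun z => V (separation x z)) y w =
      -(deriv V (separation x y) / sin (separation x y) * (w ⬝ᵥ x)) := by
  simp only [separation_comm x] at hV ⊢
  exact lineDeriv_potential h.symm hV w

/-! ### Relative equilibria as solutions of algebraic equations -/

/-- The rotation with axis `Ω = a x₁ + b x₂` in the plane of the particles for which the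
centripetal forces balance an interaction force of strength `κ` (per unit mass). -/
structure IsBalanced (κ : ℝ) (d : Rotation) (a b : ℝ) : Prop where
  config : IsConfiguration d.x₁ d.x₂
  axis : d.Ω = a • d.x₁ + b • d.x₂
  first : (a + b * cos d.q) * b = κ
  second : (a * cos d.q + b) * a = κ

theorem isConfiguration_mulVec {R : Matrix (Fin 3) (Fin 3) ℝ} (hR : Rᵀ * R = 1) {x y : Vec3}
    (h : IsConfiguration x y) : IsConfiguration (R *ᵥ x) (R *ᵥ y) := by
  have inj : Function.Injective (R *ᵥ ·) := fun u v huv => by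
    have := congrArg (Rᵀ *ᵥ ·) huv
    simpa [mulVec_mulVec, hR] using this
  refine ⟨?_, ?_, fun e => h.2.2.1 (inj e), fun e => h.2.2.2 (inj ?_)⟩
  · rw [dotProduct_mulVec_of_transpose_mul hR, h.1]
  · rw [dotProduct_mulVec_of_transpose_mul hR, h.2.1]
  · simpa [mulVec_neg] using e

/-- The subgroup preserves dot products, hence the separation, and every test vector at time `t` is
the image of one at time `0`. The Euler-Lagrange equations therefore need to be checked at time `0`
only. -/
theorem isRE_iff_forces {μ : ℝ} {V : ℝ → ℝ} (hV : ∀ q ∈ Ioo 0 π, DifferentiableAt ℝ V q)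
    (d : Rotation) : IsRE μ μ V d ↔ IsConfiguration d.x₁ d.x₂ ∧
      (∀ w, w ⬝ᵥ d.x₁ = 0 → μ * (w ⬝ᵥ (d.Ω ⨯₃ (d.Ω ⨯₃ d.x₁))) =
        deriv V d.q / sin d.q * (w ⬝ᵥ d.x₂)) ∧
      (∀ w, w ⬝ᵥ d.x₂ = 0 → μ * (w ⬝ᵥ (d.Ω ⨯₃ (d.Ω ⨯₃ d.x₂))) =
        deriv V d.q / sin d.q * (w ⬝ᵥ d.x₁)) := by
  constructor
  · rintro ⟨-, -, h⟩
    have h0 := h 0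
    simp only [deriv_rot_mulVec, rot_zero, one_mulVec] at h0
    have hd := hV _ (separation_mem h0.1)
    refine ⟨h0.1, fun w hw => ?_, fun w hw => ?_⟩
    · rw [h0.2.1 w hw, lineDeriv_potential h0.1 hd, neg_neg]; rfl
    · rw [h0.2.2 w hw, lineDeriv_potential_right h0.1 hd, neg_neg]; rfl
  · rintro ⟨h0, h1, h2⟩
    refine ⟨contDiff_rot_mulVec _ _, contDiff_rot_mulVec _ _, fun t => ?_⟩
    have hR := rot_transpose_mul d.Ω t
    have hc := isConfiguration_mulVec hR h0
    have hq : separation (rot d.Ω t *ᵥ d.x₁) (rot d.Ω t *ᵥ d.x₂) = d.q := by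
      rw [separation, dotProduct_mulVec_of_transpose_mul hR]; rfl
    have hd := hV _ (separation_mem hc)
    refine ⟨hc, fun w hw => ?_, fun w hw => ?_⟩
    · obtain ⟨w, rfl⟩ := exists_mulVec_eq_of_transpose_mul hR w
      rw [lineDeriv_potential hc hd, hq, neg_neg]
      simp only [deriv_rot_mulVec, dotProduct_mulVec_of_transpose_mul hR] at hw ⊢
      exact h1 w hw
    · obtain ⟨w, rfl⟩ := exists_mulVec_eq_of_transpose_mul hR w
      rw [lineDeriv_potential_right hc hd, hq, neg_neg]
      simp only [deriv_rot_mulVec, dotProduct_mulVec_of_transpose_mul hR] at hw ⊢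
      exact h2 w hw

/-- The difference `E` of the two sides is itself tangent at `x`; using it as the test vector yields
`E ⬝ᵥ E = 0`. -/
theorem coplanar_of_force {μ k : ℝ} {Ω x y : Vec3} (hx : x ⬝ᵥ x = 1)
    (h : ∀ w, w ⬝ᵥ x = 0 → μ * (w ⬝ᵥ (Ω ⨯₃ (Ω ⨯₃ x))) = k * (w ⬝ᵥ y)) :
    (μ * (Ω ⬝ᵥ x)) • (Ω - (Ω ⬝ᵥ x) • x) = k • (y - (x ⬝ᵥ y) • x) := by
  set E : Vec3 := (μ * (Ω ⬝ᵥ x)) • (Ω - (Ω ⬝ᵥ x) • x) - k • (y - (x ⬝ᵥ y) • x) with hE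
  have hEx : E ⬝ᵥ x = 0 := by
    simp only [hE, sub_dotProduct, smul_dotProduct, hx, smul_eq_mul, dotProduct_comm y x]
    ring
  have h1 := h E hEx
  rw [dotProduct_cross_cross, hEx] at h1
  have h2 : E ⬝ᵥ E = 0 := by
    nth_rw 2 [hE]
    simp only [dotProduct_sub, dotProduct_smul, hEx, smul_eq_mul]
    linarith
  exact sub_eq_zero.1 (dotProduct_self_eq_zero.1 h2)

theorem isRE_iff {μ : ℝ} (hμ : 0 < μ) {V : ℝ → ℝ}
    (hV : ∀ q ∈ Ioo 0 π, DifferentiableAt ℝ V q) (hV' : ∀ q ∈ Ioo 0 π, deriv V q < 0)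
    (d : Rotation) :
    IsRE μ μ V d ↔ ∃ a b, IsBalanced (deriv V d.q / (μ * sin d.q)) d a b := by
  rw [isRE_iff_forces hV]
  constructor
  · rintro ⟨hc, h1, h2⟩
    have hq := separation_mem hc
    have hs : 0 < sin d.q := sin_pos_of_mem_Ioo hq
    have hk : deriv V d.q / sin d.q ≠ 0 := (div_neg_of_neg_of_pos (hV' _ hq) hs).ne
    have hκ : deriv V d.q / (μ * sin d.q) = deriv V d.q / sin d.q / μ := by
      field_simp
    have hcos : cos d.q = d.x₁ ⬝ᵥ d.x₂ := cos_separation hc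
    have hm := dotProduct_mem_of_isConfiguration hc
    have hx := hc.1
    have hy := hc.2.1
    have e1 := coplanar_of_force hx h1
    have e2 := coplanar_of_force hy h2
    rw [dotProduct_comm d.x₂ d.x₁] at e2
    rw [hκ]
    generalize deriv V d.q / sin d.q = k at *
    have e1y := congrArg (· ⬝ᵥ d.x₂) e1
    have e2x := congrArg (· ⬝ᵥ d.x₁) e2
    simp only [smul_dotProduct, sub_dotProduct, hx, hy, smul_eq_mul, dotProduct_comm d.x₂ d.x₁]
      at e1y e2x
    have hD : (1 - (d.x₁ ⬝ᵥ d.x₂) * (d.x₁ ⬝ᵥ d.x₂)) ≠ 0 := by nlinarith [hm.1, hm.2]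
    -- If the axis were perpendicular to the first mass, `e1y` would read `0 = k (1 - c²)` with `k ≠
    -- 0`.
    have hu : d.Ω ⬝ᵥ d.x₁ ≠ 0 := by
      intro h; rw [h] at e1y; simp at e1y; tauto
    set u := d.Ω ⬝ᵥ d.x₁
    set v := d.Ω ⬝ᵥ d.x₂
    set c := d.x₁ ⬝ᵥ d.x₂
    have hΩ : d.Ω = (u - k / (μ * u) * c) • d.x₁ + (k / (μ * u)) • d.x₂ := by
      have := congrArg ((μ * u)⁻¹ • ·) e1
      simp only [smul_smul, inv_mul_cancel₀ (mul_ne_zero hμ.ne' hu), one_smul] at this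
      rw [sub_eq_iff_eq_add.1 this]
      ext i
      simp only [Pi.add_apply, Pi.smul_apply, Pi.sub_apply, smul_eq_mul]
      ring
    set b := k / (μ * u) with hb
    have hv : v = (u - b * c) * c + b := by
      have := congrArg (· ⬝ᵥ d.x₂) hΩ
      simpa only [smul_dotProduct, add_dotProduct, hy, smul_eq_mul, mul_one] using this
    have hub : b * u = k / μ := by rw [hb]; field_simp
    refine ⟨u - b * c, b, hc, hΩ, ?_, ?_⟩
    · rw [hcos, ← hub]; ring
    · rw [hcos, eq_div_iff hμ.ne']
      apply mul_right_cancel₀ hD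
      rw [← e2x, ← hv]
      have : u - v * c = (u - b * c) * (1 - c * c) := by rw [hv]; ring
      rw [this]; ring
  · rintro ⟨a, b, hc, hΩ, h1, h2⟩
    have hq := separation_mem hc
    have hs : 0 < sin d.q := sin_pos_of_mem_Ioo hq
    have hcos : cos d.q = d.x₁ ⬝ᵥ d.x₂ := cos_separation hc
    have hu : d.Ω ⬝ᵥ d.x₁ = a + b * cos d.q := by
      rw [hcos, hΩ]
      simp [add_dotProduct, smul_dotProduct, hc.1, dotProduct_comm d.x₂ d.x₁]
    have hv : d.Ω ⬝ᵥ d.x₂ = a * cos d.q + b := by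
      rw [hcos, hΩ]
      simp [add_dotProduct, smul_dotProduct, hc.2.1]
    have hk : deriv V d.q / sin d.q = μ * (deriv V d.q / (μ * sin d.q)) := by
      field_simp
    refine ⟨hc, fun w hw => ?_, fun w hw => ?_⟩
    · rw [dotProduct_cross_cross, hw, hu, hk, ← h1, hΩ]
      simp only [dotProduct_add, dotProduct_smul, hw, smul_eq_mul]
      ring
    · rw [dotProduct_cross_cross, hw, hv, hk, ← h2, hΩ]
      simp only [dotProduct_add, dotProduct_smul, hw, smul_eq_mul]
      ring

/-! ### Angles -/

theorem axisAngle_eq_of_sq {Ω x : Vec3} {θ : ℝ} (hΩ : 0 < Ω ⬝ᵥ Ω) (hθ : θ ∈ Icc 0 (π / 2))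
    (h : (Ω ⬝ᵥ x) ^ 2 = cos θ ^ 2 * (Ω ⬝ᵥ Ω)) : axisAngle Ω x = θ := by
  have hc : 0 ≤ cos θ := cos_nonneg_of_mem_Icc ⟨by linarith [hθ.1, pi_pos], hθ.2⟩
  have h1 : |Ω ⬝ᵥ x| = cos θ * √(Ω ⬝ᵥ Ω) := by
    rw [← sqrt_sq_eq_abs, h, sqrt_mul (sq_nonneg _), sqrt_sq hc]
  rw [axisAngle, h1, mul_div_assoc, div_self (sqrt_pos.2 hΩ).ne', mul_one,
    arccos_cos hθ.1 (by linarith [hθ.2, pi_pos])]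

section Balanced

variable {κ a b : ℝ} {d : Rotation}

theorem IsBalanced.q_mem (h : IsBalanced κ d a b) : d.q ∈ Ioo 0 π := separation_mem h.config

theorem IsBalanced.cos_mem (h : IsBalanced κ d a b) : cos d.q ∈ Ioo (-1 : ℝ) 1 := by
  have := dotProduct_mem_of_isConfiguration h.config
  rwa [← cos_separation h.config] at this

theorem IsBalanced.cos_q (h : IsBalanced κ d a b) : cos d.q = d.x₁ ⬝ᵥ d.x₂ :=
  cos_separation h.config

theorem IsBalanced.axis_dot_first (h : IsBalanced κ d a b) :
    d.Ω ⬝ᵥ d.x₁ = a + b * cos d.q := by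
  rw [h.cos_q, h.axis]
  simp [add_dotProduct, smul_dotProduct, h.config.1, dotProduct_comm d.x₂ d.x₁]

theorem IsBalanced.axis_dot_second (h : IsBalanced κ d a b) :
    d.Ω ⬝ᵥ d.x₂ = a * cos d.q + b := by
  rw [h.cos_q, h.axis]
  simp [add_dotProduct, smul_dotProduct, h.config.2.1]

theorem IsBalanced.axis_dot_self (h : IsBalanced κ d a b) :
    d.Ω ⬝ᵥ d.Ω = a ^ 2 + 2 * a * b * cos d.q + b ^ 2 := by
  nth_rw 2 [h.axis]
  rw [dotProduct_add, dotProduct_smul, dotProduct_smul, h.axis_dot_first, h.axis_dot_second]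
  simp only [smul_eq_mul]; ring

theorem IsBalanced.swap (h : IsBalanced κ d a b) : IsBalanced κ d.swap b a := by
  have e : d.swap.q = d.q := separation_comm _ _
  refine ⟨h.config.symm, ?_, ?_, ?_⟩
  · rw [add_comm]; exact h.axis
  · rw [e, ← h.second]; ring
  · rw [e, ← h.first]; ring

/-- This dichotomy is the whole classification: the difference of the balance equations factors, and
the sign of `κ` excludes `a = b`. -/
theorem IsBalanced.cos_eq_zero_or (h : IsBalanced κ d a b) (hκ : κ < 0) :
    cos d.q = 0 ∨ a = -b := by
  have h1 := h.first
  have h2 := h.second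
  have hc := h.cos_mem
  by_contra! hne
  have h3 : cos d.q * ((b - a) * (a + b)) = 0 := by linarith
  rcases mul_eq_zero.1 h3 with h4 | h4
  · exact hne.1 h4
  rcases mul_eq_zero.1 h4 with h5 | h5
  · have : b = a := by linarith
    subst this
    nlinarith [mul_nonneg (sq_nonneg b) (by linarith [hc.1] : (0 : ℝ) ≤ 1 + cos d.q)]
  · exact hne.2 (by linarith)

theorem IsBalanced.mul_neg (h : IsBalanced κ d a b) (hκ : κ < 0) : a * b < 0 := by
  rcases h.cos_eq_zero_or hκ with hc | rfl
  · have := h.first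
    rw [hc] at this
    linarith
  · have := h.first
    have hb : b ≠ 0 := by
      rintro rfl; linarith
    nlinarith [pow_pos (abs_pos.2 hb) 2, sq_abs b]

theorem IsBalanced.axis_dot_sum_eq_zero_iff (h : IsBalanced κ d a b) :
    d.Ω ⬝ᵥ (d.x₁ + d.x₂) = 0 ↔ a = -b := by
  rw [dotProduct_add, h.axis_dot_first, h.axis_dot_second,
    show a + b * cos d.q + (a * cos d.q + b) = (a + b) * (1 + cos d.q) by ring, mul_eq_zero,
    or_iff_left (by linarith [h.cos_mem.1]), add_eq_zero_iff_eq_neg]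

theorem IsBalanced.isosceles_angles (h : IsBalanced κ d (-b) b) (hκ : κ < 0) :
    b ^ 2 * (1 - cos d.q) = -κ ∧ d.θ₁ = (π - d.q) / 2 ∧ d.θ₂ = (π - d.q) / 2 ∧
      d.Ω ⬝ᵥ d.Ω = -2 * κ := by
  have h1 : b ^ 2 * (1 - cos d.q) = -κ := by linarith [h.first]
  have h2 : d.Ω ⬝ᵥ d.Ω = -2 * κ := by rw [h.axis_dot_self]; linarith
  have hq := h.q_mem
  have hm : (π - d.q) / 2 ∈ Icc 0 (π / 2) := ⟨by linarith [hq.2], by linarith [hq.1]⟩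
  have hc : cos ((π - d.q) / 2) ^ 2 = (1 - cos d.q) / 2 := by
    rw [cos_sq, mul_div_cancel₀ _ two_ne_zero, cos_pi_sub]; ring
  refine ⟨h1, axisAngle_eq_of_sq (by linarith) hm ?_, axisAngle_eq_of_sq (by linarith) hm ?_, h2⟩
  · rw [h.axis_dot_first, h2, hc, ← neg_eq_iff_eq_neg.2 h1]; ring
  · rw [h.axis_dot_second, h2, hc, ← neg_eq_iff_eq_neg.2 h1]; ring

/-- Here `x₁, x₂` are orthonormal, so `a` and `b` are the components of `Ω`, equal up to sign to
`|Ω| cos θ₁` and `|Ω| sin θ₁`; both balance equations become `a b = κ`. -/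
theorem IsBalanced.rightAngled_angles (h : IsBalanced κ d a b) (hκ : κ < 0) (hq : d.q = π / 2) :
    a * b = κ ∧ d.θ₁ ∈ Ioo 0 (π / 2) ∧ d.θ₂ = π / 2 - d.θ₁ ∧
      a ^ 2 = cos d.θ₁ ^ 2 * (a ^ 2 + b ^ 2) ∧ b ^ 2 = sin d.θ₁ ^ 2 * (a ^ 2 + b ^ 2) ∧
      d.Ω ⬝ᵥ d.Ω = a ^ 2 + b ^ 2 ∧ (a ^ 2 + b ^ 2) * sin (2 * d.θ₁) = -2 * κ := by
  have hab := h.mul_neg hκ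
  have ha : a ≠ 0 := left_ne_zero_of_mul hab.ne
  have hb : b ≠ 0 := right_ne_zero_of_mul hab.ne
  have h0 : cos d.q = 0 := by rw [hq, cos_pi_div_two]
  have h1 : a * b = κ := by have := h.first; rwa [h0, mul_zero, add_zero] at this
  have hN : d.Ω ⬝ᵥ d.Ω = a ^ 2 + b ^ 2 := by rw [h.axis_dot_self, h0]; ring
  have hu : d.Ω ⬝ᵥ d.x₁ = a := by rw [h.axis_dot_first, h0]; ring
  have hv : d.Ω ⬝ᵥ d.x₂ = b := by rw [h.axis_dot_second, h0]; ring
  have hNp : 0 < a ^ 2 + b ^ 2 := by positivity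
  have hlt : |a| < √(a ^ 2 + b ^ 2) := by
    apply lt_sqrt_of_sq_lt
    rw [sq_abs]
    linarith [pow_pos (abs_pos.2 hb) 2, sq_abs b]
  have hs : 0 < √(a ^ 2 + b ^ 2) := sqrt_pos.2 hNp
  have hcos : cos d.θ₁ = |a| / √(a ^ 2 + b ^ 2) := by
    rw [Rotation.θ₁, axisAngle, hu, hN, cos_arccos]
    · exact le_trans (by norm_num) (div_nonneg (abs_nonneg a) hs.le)
    · exact (div_le_one hs).2 hlt.le
  have hθ : d.θ₁ ∈ Ioo 0 (π / 2) := by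
    rw [Rotation.θ₁, axisAngle, hu, hN]
    exact ⟨arccos_pos.2 ((div_lt_one hs).2 hlt),
      arccos_lt_pi_div_two.2 (div_pos (abs_pos.2 ha) hs)⟩
  have ha2 : a ^ 2 = cos d.θ₁ ^ 2 * (a ^ 2 + b ^ 2) := by
    rw [hcos, div_pow, sq_abs, sq_sqrt hNp.le, div_mul_cancel₀ _ hNp.ne']
  have hb2 : b ^ 2 = sin d.θ₁ ^ 2 * (a ^ 2 + b ^ 2) := by
    rw [sin_sq]; linarith
  refine ⟨h1, hθ, axisAngle_eq_of_sq (hN ▸ hNp) ⟨by linarith [hθ.2], by linarith [hθ.1]⟩ ?_,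
    ha2, hb2, hN, ?_⟩
  · rw [cos_pi_div_two_sub, hN, hv]; exact hb2
  · have hsin : 0 < sin (2 * d.θ₁) :=
      sin_pos_of_mem_Ioo ⟨by linarith [hθ.1], by linarith [hθ.2]⟩
    -- Only `a²` and `b²` are known in terms of `θ₁`, so the two positive sides are compared through
    -- their squares.
    refine (sq_eq_sq₀ (by positivity) (by linarith)).1 ?_
    rw [sin_two_mul, ← h1]
    linear_combination (-4 * b ^ 2) * ha2 - (4 * cos d.θ₁ ^ 2 * (a ^ 2 + b ^ 2)) * hb2

theorem IsBalanced.q_eq_or (h : IsBalanced κ d a b) (hκ : κ < 0) : d.q = π / 2 ∨ a = -b := by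
  refine (h.cos_eq_zero_or hκ).imp_left fun h0 => ?_
  refine injOn_cos ⟨h.q_mem.1.le, h.q_mem.2.le⟩ ⟨by positivity, by linarith [pi_pos]⟩ ?_
  rw [h0, cos_pi_div_two]

end Balanced

/-! ### Uniqueness up to rotations -/

theorem mem_specialOrthogonalGroup_iff_transpose {R : Matrix (Fin 3) (Fin 3) ℝ} :
    R ∈ Matrix.specialOrthogonalGroup (Fin 3) ℝ ↔ Rᵀ * R = 1 ∧ R.det = 1 := by
  rw [Matrix.mem_specialOrthogonalGroup_iff, Matrix.mem_orthogonalGroup_iff']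

/-- The columns of `F` are the body frame `x ⨯₃ y / s`, `(y - c x) / s`, `-x`, the one used for the
reduced coordinates. The determinant is `1` by Lagrange's identity for `|x ⨯₃ y|²`. -/
theorem exists_frame {x y : Vec3} (h : IsConfiguration x y) :
    ∃ F ∈ Matrix.specialOrthogonalGroup (Fin 3) ℝ, F *ᵥ ![0, 0, -1] = x ∧
      F *ᵥ ![0, sin (separation x y), -cos (separation x y)] = y := by
  have hs : 0 < sin (separation x y) := sin_pos_of_mem_Ioo (separation_mem h)
  have hcos := cos_separation h
  have hs2 := sin_sq_add_cos_sq (separation x y)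
  set c := cos (separation x y)
  set s := sin (separation x y)
  have hx : x 0 * x 0 + x 1 * x 1 + x 2 * x 2 = 1 := by rw [← vec3_dotProduct]; exact h.1
  have hy : y 0 * y 0 + y 1 * y 1 + y 2 * y 2 = 1 := by rw [← vec3_dotProduct]; exact h.2.1
  have hxy : x 0 * y 0 + x 1 * y 1 + x 2 * y 2 = c := by rw [← vec3_dotProduct]; exact hcos.symm
  let u : Vec3 := s⁻¹ • (x ⨯₃ y)
  let v : Vec3 := s⁻¹ • (y - c • x)
  have ux : u ⬝ᵥ x = 0 := by simp [u, dotProduct_comm]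
  have uy : u ⬝ᵥ y = 0 := by
    simp [u, dotProduct_comm _ y]
  have uu : u ⬝ᵥ u = 1 := by
    simp only [u, smul_dotProduct, dotProduct_smul, cross_dot_cross, h.1, h.2.1,
      dotProduct_comm y x, ← hcos, smul_eq_mul]
    field_simp
    linarith
  have vv : v ⬝ᵥ v = 1 := by
    simp only [v, smul_dotProduct, dotProduct_smul, sub_dotProduct, dotProduct_sub, h.1, h.2.1,
      dotProduct_comm y x, ← hcos, smul_eq_mul]
    field_simp
    linarith
  have vx : v ⬝ᵥ x = 0 := by
    simp only [v, smul_dotProduct, sub_dotProduct, h.1, dotProduct_comm y x, ← hcos, smul_eq_mul]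
    ring
  have uv : u ⬝ᵥ v = 0 := by
    simp only [v, dotProduct_smul, dotProduct_sub, ux, uy, smul_eq_mul]
    ring
  have hy' : y = s • v + c • x := by
    simp only [v, smul_smul, mul_inv_cancel₀ hs.ne', one_smul]
    abel
  let F : Matrix (Fin 3) (Fin 3) ℝ := Matrix.of fun i j => ![u i, v i, -x i] j
  refine ⟨F, mem_specialOrthogonalGroup_iff_transpose.2 ⟨?_, ?_⟩, ?_, ?_⟩
  · have hxx := h.1
    simp only [vec3_dotProduct] at uu vv uv ux vx hxx
    ext i j
    fin_cases i <;> fin_cases j <;>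
      simp [F, Matrix.mul_apply, Fin.sum_univ_three] <;> linarith
  · rw [det_fin_three]
    simp only [F, u, v, of_apply, cross_apply, Pi.smul_apply, Pi.sub_apply, smul_eq_mul]
    simp only [cons_val]
    field_simp
    have : (x 0 * x 0 + x 1 * x 1 + x 2 * x 2) * (y 0 * y 0 + y 1 * y 1 + y 2 * y 2) -
      (x 0 * y 0 + x 1 * y 1 + x 2 * y 2) ^ 2 = s ^ 2 := by rw [hx, hy, hxy]; linarith
    rw [← this]
    ring
  · ext i
    simp [F, mulVec]
  · rw [hy']
    ext i
    simp [F, mulVec]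
    ring

/-- Both pairs are images of one standard pair under frames `F` and `G`, so `G * Fᵀ` matches them.
The axis follows because it is a combination of the masses; the common sign of `a, b` accounts for
time reversal. -/
theorem IsBalanced.rotCongruent {κ κ' a b a' b' : ℝ} {d d' : Rotation} (h : IsBalanced κ d a b)
    (h' : IsBalanced κ' d' a' b') (hq : d.q = d'.q)
    (hab : a' = a ∧ b' = b ∨ a' = -a ∧ b' = -b) : RotCongruent d d' := by
  obtain ⟨F, hF, hF1, hF2⟩ := exists_frame h.config
  obtain ⟨G, hG, hG1, hG2⟩ := exists_frame h'.config
  change F *ᵥ ![0, sin d.q, -cos d.q] = _ at hF2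
  change G *ᵥ ![0, sin d'.q, -cos d'.q] = _ at hG2
  have hF' := mem_specialOrthogonalGroup_iff_transpose.1 hF
  have key (w : Vec3) : (G * Fᵀ) *ᵥ (F *ᵥ w) = G *ᵥ w := by
    rw [mulVec_mulVec, Matrix.mul_assoc, hF'.1, Matrix.mul_one]
  have e1 : d'.x₁ = (G * Fᵀ) *ᵥ d.x₁ := by rw [← hF1, key, hG1]
  have e2 : d'.x₂ = (G * Fᵀ) *ᵥ d.x₂ := by rw [← hF2, key, hq, hG2]
  refine ⟨G * Fᵀ, mul_mem hG ?_, e1, e2, ?_⟩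
  · rw [mem_specialOrthogonalGroup_iff_transpose, transpose_transpose, det_transpose]
    exact ⟨mul_eq_one_comm.1 hF'.1, hF'.2⟩
  · rw [h.axis, h'.axis, mulVec_add, mulVec_smul, mulVec_smul, ← e1, ← e2]
    rcases hab with ⟨rfl, rfl⟩ | ⟨rfl, rfl⟩
    · exact Or.inl rfl
    · right; rw [neg_smul, neg_smul]; abel

/-! ### Existence -/

/-- Particles at separation `q` in standard position, with axis `Ω = a x₁ + b x₂`. -/
noncomputable def standardRotation (q a b : ℝ) : Rotation :=
  ⟨![0, 0, -1], ![0, sin q, -cos q], a • ![0, 0, -1] + b • ![0, sin q, -cos q]⟩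

theorem standardRotation_q {q : ℝ} (hq : q ∈ Ioo 0 π) (a b : ℝ) :
    (standardRotation q a b).q = q := by
  simp [standardRotation, Rotation.q, separation, arccos_cos hq.1.le hq.2.le]

theorem isBalanced_standardRotation {q κ a b : ℝ} (hq : q ∈ Ioo 0 π)
    (h1 : (a + b * cos q) * b = κ) (h2 : (a * cos q + b) * a = κ) :
    IsBalanced κ (standardRotation q a b) a b := by
  have hs : sin q ≠ 0 := (sin_pos_of_mem_Ioo hq).ne'
  refine ⟨⟨?_, ?_, fun e => ?_, fun e => ?_⟩, rfl, ?_, ?_⟩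
  · simp [standardRotation]
  · simp [standardRotation]
    linarith [sin_sq_add_cos_sq q]
  · exact hs (by simpa [standardRotation] using (congrFun e 1).symm)
  · exact hs (by simpa [standardRotation] using congrFun e 1)
  · rwa [standardRotation_q hq]
  · rwa [standardRotation_q hq]

/-- The isosceles configuration with separation `q`. -/
noncomputable def isoscelesRotation (κ q : ℝ) : Rotation :=
  standardRotation q (-√(-κ / (1 - cos q))) √(-κ / (1 - cos q))

theorem isoscelesRotation_q {q : ℝ} (hq : q ∈ Ioo 0 π) (κ : ℝ) :
    (isoscelesRotation κ q).q = q := standardRotation_q hq _ _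

theorem isBalanced_isoscelesRotation {q κ : ℝ} (hq : q ∈ Ioo 0 π) (hκ : κ < 0) :
    IsBalanced κ (isoscelesRotation κ q) (-√(-κ / (1 - cos q))) √(-κ / (1 - cos q)) := by
  have hc : 0 < 1 - cos q := by
    have := cos_lt_cos_of_nonneg_of_le_pi le_rfl hq.2.le hq.1
    rw [cos_zero] at this; linarith
  have h : √(-κ / (1 - cos q)) ^ 2 * (1 - cos q) = -κ := by
    rw [sq_sqrt (div_nonneg (by linarith) hc.le), div_mul_cancel₀ _ hc.ne']
  apply isBalanced_standardRotation hq <;> linarith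

theorem tan_pi_div_four_add_mul {s : ℝ} (hs : s ∈ Ioo (-(π / 4)) (π / 4)) :
    0 < tan (π / 4 + s) ∧ 0 < tan (π / 4 - s) ∧ tan (π / 4 + s) * tan (π / 4 - s) = 1 := by
  have h1 : 0 < tan (π / 4 + s) :=
    tan_pos_of_pos_of_lt_pi_div_two (by linarith [hs.1]) (by linarith [hs.2])
  have h : π / 4 - s = π / 2 - (π / 4 + s) := by ring
  rw [h, tan_pi_div_two_sub]
  exact ⟨h1, inv_pos.2 h1, mul_inv_cancel₀ h1.ne'⟩

/-- The right-angled configuration with `θ₁ = π / 4 + s`. -/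
noncomputable def rightAngledRotation (κ s : ℝ) : Rotation :=
  standardRotation (π / 2) (-√(-κ * tan (π / 4 - s))) √(-κ * tan (π / 4 + s))

theorem isBalanced_rightAngledRotation {κ s : ℝ} (hκ : κ < 0)
    (hs : s ∈ Ioo (-(π / 4)) (π / 4)) :
    IsBalanced κ (rightAngledRotation κ s) (-√(-κ * tan (π / 4 - s))) √(-κ * tan (π / 4 + s)) := by
  obtain ⟨h1, h2, h3⟩ := tan_pi_div_four_add_mul hs
  have h : √(-κ * tan (π / 4 - s)) * √(-κ * tan (π / 4 + s)) = -κ := by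
    rw [← sqrt_mul (mul_nonneg (by linarith) h2.le),
      show -κ * tan (π / 4 - s) * (-κ * tan (π / 4 + s)) =
        (-κ) ^ 2 * (tan (π / 4 + s) * tan (π / 4 - s)) by ring, h3, mul_one,
      sqrt_sq (by linarith)]
  apply isBalanced_standardRotation ⟨by positivity, by linarith [pi_pos]⟩ <;>
    rw [cos_pi_div_two] <;> linarith

theorem rightAngledRotation_q (κ s : ℝ) : (rightAngledRotation κ s).q = π / 2 :=
  standardRotation_q ⟨by positivity, by linarith [pi_pos]⟩ _ _

theorem rightAngledRotation_θ {κ s : ℝ} (hκ : κ < 0) (hs : s ∈ Ioo (-(π / 4)) (π / 4)) :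
    (rightAngledRotation κ s).θ = π / 4 - |s| := by
  have hb := isBalanced_rightAngledRotation hκ hs
  obtain ⟨h1, h2, h3⟩ := tan_pi_div_four_add_mul hs
  obtain ⟨-, hθ, hθ2, ha, hb2, -, -⟩ := hb.rightAngled_angles hκ (rightAngledRotation_q κ s)
  rw [neg_sq, sq_sqrt (mul_nonneg (by linarith) h2.le),
    sq_sqrt (mul_nonneg (by linarith) h1.le)] at ha hb2
  have hθs : (rightAngledRotation κ s).θ₁ = π / 4 + s := by
    generalize (rightAngledRotation κ s).θ₁ = θ at *
    have hN : 0 < -κ * tan (π / 4 - s) + -κ * tan (π / 4 + s) := by nlinarith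
    have hc : 0 < cos θ := cos_pos_of_mem_Ioo ⟨by linarith [hθ.1, pi_pos], hθ.2⟩
    have ht : 0 < tan θ := tan_pos_of_pos_of_lt_pi_div_two hθ.1 hθ.2
    have htan : tan θ = tan (π / 4 + s) := by
      refine (sq_eq_sq₀ ht.le h1.le).1 ?_
      rw [tan_eq_sin_div_cos θ, div_pow, div_eq_iff (by positivity)]
      apply mul_right_cancel₀ hN.ne'
      rw [← hb2, mul_assoc, ← ha]
      linear_combination κ * tan (π / 4 + s) * h3
    exact injOn_tan ⟨by linarith [hθ.1, pi_pos], hθ.2⟩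
      ⟨by linarith [hs.1, pi_pos], by linarith [hs.2]⟩ htan
  rw [Rotation.θ, hθ2, hθs]
  rcases le_total 0 s with h | h
  · rw [abs_of_nonneg h, min_eq_right (by linarith)]; ring
  · rw [abs_of_nonpos h, min_eq_left (by linarith)]; ring

theorem IsBalanced.rotCongruent_of_θ₁_eq {κ a b a' b' : ℝ} {d d' : Rotation}
    (h : IsBalanced κ d a b) (h' : IsBalanced κ d' a' b') (hκ : κ < 0) (hq : d.q = π / 2)
    (hq' : d'.q = π / 2) (hθ : d.θ₁ = d'.θ₁) : RotCongruent d d' := by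
  obtain ⟨h1, hm, -, ha, -, -, hN⟩ := h.rightAngled_angles hκ hq
  obtain ⟨h1', -, -, ha', -, -, hN'⟩ := h'.rightAngled_angles hκ hq'
  rw [← hθ] at ha' hN'
  have hsin : sin (2 * d.θ₁) ≠ 0 :=
    (sin_pos_of_mem_Ioo ⟨by linarith [hm.1], by linarith [hm.2]⟩).ne'
  have hNN : a ^ 2 + b ^ 2 = a' ^ 2 + b' ^ 2 := mul_right_cancel₀ hsin (hN.trans hN'.symm)
  have ha0 : a ≠ 0 := by rintro rfl; linarith
  refine h.rotCongruent h' (hq.trans hq'.symm) ?_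
  rcases sq_eq_sq_iff_eq_or_eq_neg.1 (show a' ^ 2 = a ^ 2 by rw [ha, ha', hNN]) with e | e
  · exact Or.inl ⟨e, mul_left_cancel₀ ha0 (by rw [h1, ← e, h1'])⟩
  · refine Or.inr ⟨e, mul_left_cancel₀ ha0 ?_⟩
    rw [e] at h1'; linarith

/-! ### Classification of the relative equilibria -/

/-- The strength of the interaction force per unit mass: the derivative of the potential at `q`,
divided by `μ sin q`. -/
noncomputable def coupling (μ : ℝ) (V : ℝ → ℝ) (q : ℝ) : ℝ := deriv V q / (μ * sin q)

theorem coupling_neg {μ : ℝ} (hμ : 0 < μ) {V : ℝ → ℝ} (hV' : ∀ q ∈ Ioo 0 π, deriv V q < 0)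
    {q : ℝ} (hq : q ∈ Ioo 0 π) : coupling μ V q < 0 :=
  div_neg_of_neg_of_pos (hV' q hq) (mul_pos hμ (sin_pos_of_mem_Ioo hq))

section

variable {μ : ℝ} {V : ℝ → ℝ}

theorem differentiableAt_potential (hV : ContDiffOn ℝ ∞ V (Ioo 0 π)) :
    ∀ q ∈ Ioo 0 π, DifferentiableAt ℝ V q := fun q hq =>
  (hV.contDiffAt (Ioo_mem_nhds hq.1 hq.2)).differentiableAt (by simp)

theorem isRE_iff_balanced (hμ : 0 < μ) (hV : ContDiffOn ℝ ∞ V (Ioo 0 π))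
    (hV' : ∀ q ∈ Ioo 0 π, deriv V q < 0) (d : Rotation) :
    IsRE μ μ V d ↔ ∃ a b, IsBalanced (coupling μ V d.q) d a b :=
  isRE_iff hμ (differentiableAt_potential hV) hV' d

theorem pi_div_two_mem : π / 2 ∈ Ioo 0 π := ⟨by positivity, by linarith [pi_pos]⟩

theorem coupling_pi_div_two : coupling μ V (π / 2) = deriv V (π / 2) / μ := by
  rw [coupling, sin_pi_div_two, mul_one]

theorem geometry_of_isRE (hμ : 0 < μ) (hV : ContDiffOn ℝ ∞ V (Ioo 0 π))
    (hV' : ∀ q ∈ Ioo 0 π, deriv V q < 0) (d : Rotation) (hd : IsRE μ μ V d) :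
    d.SameSide ∧
    d.θ₁ ∈ Ioo 0 (π / 2) ∧ d.θ₂ ∈ Ioo 0 (π / 2) ∧ d.q = π - (d.θ₁ + d.θ₂) ∧
    μ / 2 * sin (2 * d.θ₁) = μ / 2 * sin (2 * d.θ₂) ∧
    d.Ω ⬝ᵥ d.Ω = -(μ / 2 * sin (2 * d.θ₁))⁻¹ * deriv V d.q ∧
    (IsIsoscelesRE μ V d ∨ IsRightAngledRE μ V d) ∧
    (IsRightAngledRE μ V d → d.θ ∈ Ioc 0 (π / 4)) ∧
    (IsIsoscelesRE μ V d ∧ IsRightAngledRE μ V d ↔ d.q = π / 2 ∧ d.θ = π / 4) := by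
  obtain ⟨a, b, h⟩ := (isRE_iff_balanced hμ hV hV' d).1 hd
  have hq := h.q_mem
  have hs := sin_pos_of_mem_Ioo hq
  have hκ := coupling_neg hμ hV' hq
  have hiso : IsIsoscelesRE μ V d ↔ a = -b := by
    rw [IsIsoscelesRE, h.axis_dot_sum_eq_zero_iff, and_iff_right hd]
  have hright : IsRightAngledRE μ V d ↔ d.q = π / 2 := and_iff_right hd
  refine ⟨⟨a, b, h.mul_neg hκ, h.axis⟩, ?_⟩
  rw [hiso, hright]
  by_cases hq2 : d.q = π / 2
  · obtain ⟨h1, hθ, hθ2, ha, hb, hN, hN2⟩ := h.rightAngled_angles hκ hq2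
    have hsin : 0 < sin (2 * d.θ₁) :=
      sin_pos_of_mem_Ioo ⟨by linarith [hθ.1], by linarith [hθ.2]⟩
    refine ⟨hθ, ?_, ?_, ?_, ?_, Or.inr hq2, fun _ => ?_, ?_⟩
    · rw [hθ2]; exact ⟨by linarith [hθ.2], by linarith [hθ.1]⟩
    · rw [hq2, hθ2]; ring
    · rw [hθ2, show 2 * (π / 2 - d.θ₁) = π - 2 * d.θ₁ by ring, sin_pi_sub]
    · rw [hN, eq_div_of_mul_eq hsin.ne' hN2, coupling, hq2, sin_pi_div_two]
      field_simp
    · rw [Rotation.θ, hθ2]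
      refine ⟨lt_min hθ.1 (by linarith [hθ.2]), ?_⟩
      rcases le_total d.θ₁ (π / 4) with h | h
      · exact min_le_of_left_le h
      · exact min_le_of_right_le (by linarith)
    · rw [and_iff_left hq2, and_iff_right hq2]
      constructor
      · rintro rfl
        obtain ⟨-, e1, e2, -⟩ := h.isosceles_angles hκ
        rw [Rotation.θ, e1, e2, hq2, min_self]; ring
      · intro e
        have e1 : d.θ₁ = π / 4 := by
          rw [Rotation.θ, hθ2] at e
          rcases le_total d.θ₁ (π / 2 - d.θ₁) with h | h
          · rwa [min_eq_left h] at e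
          · rw [min_eq_right h] at e; linarith
        rw [e1, cos_pi_div_four] at ha
        rw [e1, sin_pi_div_four, ← ha] at hb
        rcases sq_eq_sq_iff_eq_or_eq_neg.1 hb with e | e
        · subst e; nlinarith [h.mul_neg hκ]
        · linarith
  · obtain rfl := (h.q_eq_or hκ).resolve_left hq2
    obtain ⟨-, e1, e2, hN⟩ := h.isosceles_angles hκ
    have hm : (π - d.q) / 2 ∈ Ioo 0 (π / 2) := ⟨by linarith [hq.2], by linarith [hq.1]⟩
    rw [e1, e2]
    refine ⟨hm, hm, by ring, rfl, ?_, Or.inl rfl, fun h => absurd h hq2, ?_⟩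
    · rw [hN, mul_div_cancel₀ _ two_ne_zero, sin_pi_sub, coupling]
      field_simp
    · simp [hq2]

theorem isIsoscelesRE_isoscelesRotation (hμ : 0 < μ) (hV : ContDiffOn ℝ ∞ V (Ioo 0 π))
    (hV' : ∀ q ∈ Ioo 0 π, deriv V q < 0) {q : ℝ} (hq : q ∈ Ioo 0 π) :
    IsIsoscelesRE μ V (isoscelesRotation (coupling μ V q) q) := by
  have h := isBalanced_isoscelesRotation hq (coupling_neg hμ hV' hq)
  refine ⟨(isRE_iff_balanced hμ hV hV' _).2 ?_, h.axis_dot_sum_eq_zero_iff.2 rfl⟩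
  rw [isoscelesRotation_q hq]
  exact ⟨_, _, h⟩

theorem isRightAngledRE_rightAngledRotation (hμ : 0 < μ) (hV : ContDiffOn ℝ ∞ V (Ioo 0 π))
    (hV' : ∀ q ∈ Ioo 0 π, deriv V q < 0) {s : ℝ} (hs : s ∈ Ioo (-(π / 4)) (π / 4)) :
    IsRightAngledRE μ V (rightAngledRotation (coupling μ V (π / 2)) s) := by
  have h := isBalanced_rightAngledRotation (coupling_neg hμ hV' pi_div_two_mem) hs
  refine ⟨(isRE_iff_balanced hμ hV hV' _).2 ?_, rightAngledRotation_q _ _⟩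
  rw [rightAngledRotation_q]
  exact ⟨_, _, h⟩

theorem isosceles_class (hμ : 0 < μ) (hV : ContDiffOn ℝ ∞ V (Ioo 0 π))
    (hV' : ∀ q ∈ Ioo 0 π, deriv V q < 0) {q : ℝ} (hq : q ∈ Ioo 0 π) (hq2 : q ≠ π / 2) :
    (∃ d, IsRE μ μ V d ∧ d.q = q) ∧
    (∀ d, IsRE μ μ V d → d.q = q → IsIsoscelesRE μ V d) ∧
    (∀ d d', IsRE μ μ V d → d.q = q → IsRE μ μ V d' → d'.q = q → RotCongruent d d') := by
  have hκ := coupling_neg hμ hV' hq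
  have iso {d : Rotation} {a b : ℝ} (h : IsBalanced (coupling μ V d.q) d a b) (e : d.q = q) :
      a = -b := (h.q_eq_or (e ▸ hκ)).resolve_left (e ▸ hq2)
  refine ⟨⟨_, (isIsoscelesRE_isoscelesRotation hμ hV hV' hq).1, isoscelesRotation_q hq _⟩,
    fun d hd e => ?_, fun d d' hd e hd' e' => ?_⟩
  · obtain ⟨a, b, h⟩ := (isRE_iff_balanced hμ hV hV' d).1 hd
    exact ⟨hd, h.axis_dot_sum_eq_zero_iff.2 (iso h e)⟩
  · obtain ⟨a, b, h⟩ := (isRE_iff_balanced hμ hV hV' d).1 hd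
    obtain ⟨a', b', h'⟩ := (isRE_iff_balanced hμ hV hV' d').1 hd'
    obtain rfl := iso h e
    obtain rfl := iso h' e'
    rw [e] at h
    rw [e'] at h'
    have h1 := (h.isosceles_angles hκ).1
    have h2 := (h'.isosceles_angles hκ).1
    have hc : 1 - cos d.q ≠ 0 := by linarith [h.cos_mem.2]
    rw [e'.trans e.symm] at h2
    refine h.rotCongruent h' (e.trans e'.symm) ?_
    rcases sq_eq_sq_iff_eq_or_eq_neg.1 (mul_right_cancel₀ hc (h2.trans h1.symm)) with e | e <;>
      simp [e]

theorem rightAngled_class (hμ : 0 < μ) (hV : ContDiffOn ℝ ∞ V (Ioo 0 π))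
    (hV' : ∀ q ∈ Ioo 0 π, deriv V q < 0) {θ : ℝ} (hθ : θ ∈ Ioc 0 (π / 4)) :
    (∃ d, IsRightAngledRE μ V d ∧ d.θ = θ) ∧
    (∀ d d', IsRightAngledRE μ V d → d.θ = θ → IsRightAngledRE μ V d' → d'.θ = θ →
      RotCongruent d d' ∨ RotCongruent d.swap d') := by
  have hκ := coupling_neg hμ hV' pi_div_two_mem
  have hs : π / 4 - θ ∈ Ioo (-(π / 4)) (π / 4) := ⟨by linarith [hθ.2, pi_pos], by linarith [hθ.1]⟩
  constructor
  · refine ⟨_, isRightAngledRE_rightAngledRotation hμ hV hV' hs,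
      (rightAngledRotation_θ hκ hs).trans ?_⟩
    rw [abs_of_nonneg (by linarith [hθ.2])]; ring
  · rintro d d' ⟨hd, hq⟩ hdθ ⟨hd', hq'⟩ hdθ'
    obtain ⟨a, b, h⟩ := (isRE_iff_balanced hμ hV hV' d).1 hd
    obtain ⟨a', b', h'⟩ := (isRE_iff_balanced hμ hV hV' d').1 hd'
    rw [hq] at h
    rw [hq'] at h'
    obtain ⟨-, -, e, -⟩ := h.rightAngled_angles hκ hq
    obtain ⟨-, -, e', -⟩ := h'.rightAngled_angles hκ hq'
    have hmin : min d.θ₁ d.θ₂ = min d'.θ₁ d'.θ₂ := hdθ.trans hdθ'.symm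
    by_cases h1 : d.θ₁ = d'.θ₁
    · exact Or.inl (h.rotCongruent_of_θ₁_eq h' hκ hq hq' h1)
    -- Since `θ₁ + θ₂ = π / 2` for both, equal minima with `θ₁` different force `θ₂` of one to be
    -- `θ₁` of the other.
    · refine Or.inr (h.swap.rotCongruent_of_θ₁_eq h' hκ ((separation_comm _ _).trans hq) hq' ?_)
      change d.θ₂ = d'.θ₁
      rcases le_total d.θ₁ d.θ₂ with l | l <;> rcases le_total d'.θ₁ d'.θ₂ with l' | l' <;>
        simp only [l, l', min_eq_left, min_eq_right] at hmin
      · exact absurd hmin h1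
      · linarith
      · linarith
      · exact absurd (by linarith) h1

end

/-! ### Reduction -/

/-- The angular momentum is `μ (2Ω - (Ω·x₁) x₁ - (Ω·x₂) x₂)`. As `Ω` lies in the plane of the
masses, so does this vector, whence `m₁ = 0`; the velocities are normal to that plane, whence `p =
0`. -/
theorem IsBalanced.reduced {κ a b : ℝ} {d : Rotation} (h : IsBalanced κ d a b) (μ : ℝ) :
    d.reduced μ μ =
      ![d.q, 0, 0, μ * sin d.q * (b - a * cos d.q), -(μ * sin d.q ^ 2 * a)] := by
  have hs : sin d.q ≠ 0 := (sin_pos_of_mem_Ioo h.q_mem).ne'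
  have hs2 : sin d.q ^ 2 = 1 - cos d.q ^ 2 := sin_sq d.q
  have hu := h.axis_dot_first
  have hv := h.axis_dot_second
  have hx := h.config.1
  have hy := h.config.2.1
  have hxy := h.cos_q.symm
  have hyx : d.x₂ ⬝ᵥ d.x₁ = cos d.q := by rw [dotProduct_comm, hxy]
  have hJ (w : Vec3) : (μ • (d.x₁ ⨯₃ (d.Ω ⨯₃ d.x₁)) + μ • (d.x₂ ⨯₃ (d.Ω ⨯₃ d.x₂))) ⬝ᵥ w =
      μ * (2 * (d.Ω ⬝ᵥ w) - (a + b * cos d.q) * (d.x₁ ⬝ᵥ w) -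
        (a * cos d.q + b) * (d.x₂ ⬝ᵥ w)) := by
    rw [add_dotProduct, smul_dotProduct, smul_dotProduct, cross_cross_dotProduct,
      cross_cross_dotProduct, hu, hv, hx, hy]
    simp only [smul_eq_mul]; ring
  have hΩ (w : Vec3) : d.Ω ⬝ᵥ w = a * (d.x₁ ⬝ᵥ w) + b * (d.x₂ ⬝ᵥ w) := by
    rw [h.axis]; simp [add_dotProduct, smul_dotProduct]
  have h1 : (d.Ω ⨯₃ d.x₂) ⬝ᵥ (cos d.q • d.x₂ - d.x₁) = 0 := by
    rw [h.axis]
    simp only [map_add, map_smul, LinearMap.add_apply, LinearMap.smul_apply, cross_self, smul_zero,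
      add_zero, dotProduct_comm _ (cos d.q • d.x₂ - d.x₁), dotProduct_smul, sub_dotProduct,
      smul_dotProduct, dot_self_cross, dot_cross_self, sub_zero]
  have e (i : Fin 5) (p q : Red) (h0 : p 0 = q 0) (h1 : p 1 = q 1) (h2 : p 2 = q 2)
      (h3 : p 3 = q 3) (h4 : p 4 = q 4) : p i = q i := by fin_cases i <;> assumption
  change reduce μ μ d.x₁ d.x₂ (d.Ω ⨯₃ d.x₁) (d.Ω ⨯₃ d.x₂) = _
  ext i
  apply e
  · rfl
  · change μ * ((d.Ω ⨯₃ d.x₂) ⬝ᵥ (cos d.q • d.x₂ - d.x₁)) / sin d.q = 0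
    rw [h1, mul_zero, zero_div]
  · change (_ ⬝ᵥ (d.x₁ ⨯₃ d.x₂)) / sin d.q = 0
    rw [hJ, hΩ, dot_self_cross, dot_cross_self]
    simp
  · change (_ ⬝ᵥ (d.x₂ - cos d.q • d.x₁)) / sin d.q = μ * sin d.q * (b - a * cos d.q)
    rw [hJ, hΩ, div_eq_iff hs]
    simp only [dotProduct_sub, dotProduct_smul, hx, hy, hxy, hyx, smul_eq_mul]
    linear_combination (-μ * (b - a * cos d.q)) * hs2
  · change -(_ ⬝ᵥ d.x₁) = -(μ * sin d.q ^ 2 * a)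
    rw [hJ, hΩ, hx, hyx, hs2]
    ring

/-! ### The reduced vector field for equal masses -/

theorem red_ext {z w : Red} (h0 : z 0 = w 0) (h1 : z 1 = w 1) (h2 : z 2 = w 2)
    (h3 : z 3 = w 3) (h4 : z 4 = w 4) : z = w := by
  ext i; fin_cases i <;> assumption

/-- The reduced Hamiltonian is quadratic in each of `p, m₁, m₂, m₃`, so those partial derivatives
are linear coefficients; only `q` needs calculus. -/
theorem pd_of_quadratic {i : Fin 5} {F : Red → ℝ} {z : Red} (A B : ℝ)
    (h : ∀ t : ℝ, F (z + t • Pi.single i 1) = F z + t * A + t ^ 2 * B) : pd i F z = A := by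
  have : HasDerivAt (fun t : ℝ => F z + t * A + t ^ 2 * B) A 0 := by
    exact ((((hasDerivAt_id (0 : ℝ)).mul_const A).const_add (F z)).add
      (((hasDerivAt_id (0 : ℝ)).pow 2).mul_const B)).congr_deriv (by simp)
  rw [pd, lineDeriv, funext h, this.deriv]

theorem pd_zero_of_hasDerivAt {F : Red → ℝ} {z : Red} {f : ℝ → ℝ} {A : ℝ}
    (h : ∀ t : ℝ, F (z + t • Pi.single 0 1) = f (z 0 + t)) (hf : HasDerivAt f A (z 0)) :
    pd 0 F z = A := by
  rw [pd, lineDeriv, funext h]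
  exact (HasDerivAt.comp_const_add (z 0) 0 (by simpa using hf)).deriv

section EqualMasses

variable {μ : ℝ} {V : ℝ → ℝ} {z : Red}

theorem pd_one_redH (hμ : μ ≠ 0) : pd 1 (redH μ μ V) z = (2 * z 1 - z 2) / μ := by
  refine pd_of_quadratic _ (1 / μ) fun t => ?_
  simp [redH]
  field_simp
  ring

theorem pd_two_redH (hμ : μ ≠ 0) : pd 2 (redH μ μ V) z = (z 2 - z 1) / μ := by
  refine pd_of_quadratic _ (1 / (2 * μ)) fun t => ?_
  simp [redH]
  field_simp
  ring

theorem pd_three_redH (hμ : μ ≠ 0) :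
    pd 3 (redH μ μ V) z = (z 3 - cos (z 0) / sin (z 0) * z 4) / μ := by
  refine pd_of_quadratic _ (1 / (2 * μ)) fun t => ?_
  simp [redH]
  field_simp
  ring

theorem pd_four_redH (hμ : μ ≠ 0) :
    pd 4 (redH μ μ V) z =
      (-(cos (z 0) / sin (z 0) * z 3) + (1 + cos (z 0) ^ 2) / sin (z 0) ^ 2 * z 4) / μ := by
  refine pd_of_quadratic _ ((1 + cos (z 0) ^ 2) / sin (z 0) ^ 2 / (2 * μ)) fun t => ?_
  simp [redH]
  generalize cos (z 0) / sin (z 0) = k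
  field_simp
  ring

theorem hasDerivAt_cos_div_sin {q : ℝ} (hq : sin q ≠ 0) :
    HasDerivAt (fun q => cos q / sin q) (-1 / sin q ^ 2) q := by
  refine ((hasDerivAt_cos q).div (hasDerivAt_sin q) hq).congr_deriv ?_
  rw [← sin_sq_add_cos_sq q]; ring

theorem hasDerivAt_one_add_cos_sq_div {q : ℝ} (hq : sin q ≠ 0) :
    HasDerivAt (fun q => (1 + cos q ^ 2) / sin q ^ 2) (-4 * cos q / sin q ^ 3) q := by
  refine ((((hasDerivAt_cos q).pow 2).const_add 1).div ((hasDerivAt_sin q).pow 2)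
    (pow_ne_zero 2 hq)).congr_deriv ?_
  simp only [Pi.pow_apply]
  field_simp
  have := sin_sq_add_cos_sq q
  push_cast
  linear_combination (-2 * cos q * sin q) * this

theorem pd_zero_redH (hμ : μ ≠ 0) (hs : sin (z 0) ≠ 0) (hV : DifferentiableAt ℝ V (z 0)) :
    pd 0 (redH μ μ V) z =
      (z 3 * z 4 / sin (z 0) ^ 2 - 2 * cos (z 0) / sin (z 0) ^ 3 * z 4 ^ 2) / μ
        + deriv V (z 0) := by
  have h1 := hasDerivAt_cos_div_sin hs
  have h2 := hasDerivAt_one_add_cos_sq_div hs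
  have h3 := ((((h1.const_mul (-2 * μ * z 3 * z 4)).add (h2.const_mul (μ * z 4 ^ 2))).const_add
    ((2 * μ) * z 1 ^ 2 - 2 * μ * z 1 * z 2 + μ * z 2 ^ 2 + μ * z 3 ^ 2)).div_const
    (2 * μ * μ)).add hV.hasDerivAt
  refine (pd_zero_of_hasDerivAt (fun t => ?_) h3).trans ?_
  · simp [redH]
    generalize cos (z 0 + t) / sin (z 0 + t) = k
    field_simp
    ring
  · field_simp
    ring

theorem redField_eq (hμ : μ ≠ 0) (hs : sin (z 0) ≠ 0) (hV : DifferentiableAt ℝ V (z 0)) :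
    redField μ μ V z =
      ![(2 * z 1 - z 2) / μ,
        -((z 3 * z 4 / sin (z 0) ^ 2 - 2 * cos (z 0) / sin (z 0) ^ 3 * z 4 ^ 2) / μ
          + deriv V (z 0)),
        (cos (z 0) / sin (z 0) * (z 4 ^ 2 - z 3 ^ 2)
          + 2 * (cos (z 0) / sin (z 0)) ^ 2 * z 3 * z 4) / μ,
        (z 4 * (z 2 - z 1) - z 2 * (-(cos (z 0) / sin (z 0) * z 3)
          + (1 + cos (z 0) ^ 2) / sin (z 0) ^ 2 * z 4)) / μ,
        (z 2 * (z 3 - cos (z 0) / sin (z 0) * z 4) - z 3 * (z 2 - z 1)) / μ] := by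
  have h := sin_sq_add_cos_sq (z 0)
  rw [redField, pd_zero_redH hμ hs hV, pd_one_redH hμ, pd_two_redH hμ, pd_three_redH hμ,
    pd_four_redH hμ]
  apply red_ext
  · rfl
  · rfl
  · simp [cross_apply]
    field_simp
    linear_combination (-z 3 * z 4) * h
  · simp [cross_apply]
    field_simp
  · simp [cross_apply]
    field_simp

end EqualMasses

/-! ### Derivatives on the reduced phase space -/

theorem fderiv_of_components {F : Red → Red} {z : Red} {L₀ L₁ L₂ L₃ L₄ : Red →L[ℝ] ℝ}
    (h₀ : HasFDerivAt (fun z => F z 0) L₀ z) (h₁ : HasFDerivAt (fun z => F z 1) L₁ z)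
    (h₂ : HasFDerivAt (fun z => F z 2) L₂ z) (h₃ : HasFDerivAt (fun z => F z 3) L₃ z)
    (h₄ : HasFDerivAt (fun z => F z 4) L₄ z) (w : Red) :
    fderiv ℝ F z w = ![L₀ w, L₁ w, L₂ w, L₃ w, L₄ w] := by
  have h : ∀ i, HasFDerivAt (fun z => F z i) (![L₀, L₁, L₂, L₃, L₄] i) z := by
    intro i; fin_cases i <;> assumption
  rw [(hasFDerivAt_pi.2 h).fderiv]
  apply red_ext <;> rfl

theorem fderiv_casimir (z w : Red) :
    fderiv ℝ casimir z w = 2 * (z 2 * w 2 + z 3 * w 3 + z 4 * w 4) := by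
  have h (i : Fin 5) : HasFDerivAt (fun z : Red => z i ^ 2) _ z :=
    (hasFDerivAt_apply (𝕜 := ℝ) i z).pow 2
  have := (((h 2).add (h 3)).add (h 4)).fderiv
  change fderiv ℝ casimir z = _ at this
  rw [this]
  simp
  ring

theorem fderiv_mirrorSwap (z w : Red) :
    fderiv ℝ mirrorSwap z w =
      ![w 0, w 1 - w 2, -w 2,
        -sin (z 0) * w 0 * z 3 + cos (z 0) * w 3 + cos (z 0) * w 0 * z 4 + sin (z 0) * w 4,
        cos (z 0) * w 0 * z 3 + sin (z 0) * w 3 + sin (z 0) * w 0 * z 4 - cos (z 0) * w 4] := by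
  have h (i : Fin 5) : HasFDerivAt (fun z : Red => z i)
      (ContinuousLinearMap.proj i : Red →L[ℝ] ℝ) z := hasFDerivAt_apply i z
  rw [fderiv_of_components (F := mirrorSwap) (h 0) ((h 1).sub (h 2)) (h 2).neg
    (((h 0).cos.mul (h 3)).add ((h 0).sin.mul (h 4)))
    (((h 0).sin.mul (h 3)).sub ((h 0).cos.mul (h 4)))]
  apply red_ext <;> simp <;> ring

/-! ### Symmetry -/

theorem mirrorSwap_mirrorSwap (z : Red) : mirrorSwap (mirrorSwap z) = z := by
  have h := sin_sq_add_cos_sq (z 0)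
  apply red_ext
  · rfl
  · simp [mirrorSwap]
  · simp [mirrorSwap]
  · simp [mirrorSwap]; linear_combination z 3 * h
  · simp [mirrorSwap]; linear_combination z 4 * h

/-- On `(m₂, m₃)` the symmetry is an orthogonal reflection depending on `q`, and it flips the sign
of `m₁`. -/
theorem casimir_mirrorSwap (z : Red) : casimir (mirrorSwap z) = casimir z := by
  have h := sin_sq_add_cos_sq (z 0)
  simp [casimir, mirrorSwap]
  linear_combination (z 3 ^ 2 + z 4 ^ 2) * h

theorem fderiv_casimir_redField (μ₁ μ₂ : ℝ) (V : ℝ → ℝ) (z : Red) :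
    fderiv ℝ casimir z (redField μ₁ μ₂ V z) = 0 := by
  rw [fderiv_casimir]
  simp [redField, cross_apply]
  ring

section EqualMasses

variable {μ : ℝ} {V : ℝ → ℝ} {z : Red}

theorem redField_mirrorSwap (hμ : μ ≠ 0) (hs : sin (z 0) ≠ 0) (hV : DifferentiableAt ℝ V (z 0)) :
    redField μ μ V (mirrorSwap z) = fderiv ℝ mirrorSwap z (redField μ μ V z) := by
  have h := sin_sq_add_cos_sq (z 0)
  rw [fderiv_mirrorSwap, redField_eq hμ hs hV, redField_eq (z := mirrorSwap z) hμ hs hV]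
  apply red_ext
  · simp [mirrorSwap]; ring
  · simp [mirrorSwap]
    generalize deriv V (z 0) = v
    generalize cos (z 0) = C at *
    generalize sin (z 0) = S at *
    field_simp
    grind
  · simp [mirrorSwap]
    generalize cos (z 0) = C at *
    generalize sin (z 0) = S at *
    field_simp
    grind
  · simp [mirrorSwap]
    generalize cos (z 0) = C at *
    generalize sin (z 0) = S at *
    field_simp
    grind
  · simp [mirrorSwap]
    generalize cos (z 0) = C at *
    generalize sin (z 0) = S at *
    field_simp
    grind

/-! ### Equilibria -/

/-- Positivity of `m₂, m₃` selects the sheet containing the crossing; it rules out `m₁ ≠ 0` and the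
second root of the quadratic relation between `m₂` and `m₃`. -/
theorem redField_eq_zero_iff (hμ : 0 < μ) (hz : z 0 ∈ Ioo 0 π) (hV : DifferentiableAt ℝ V (z 0))
    (h3 : 0 < z 3) (h4 : 0 < z 4) :
    redField μ μ V z = 0 ↔ z 1 = 0 ∧ z 2 = 0 ∧
      (z 0 = π / 2 ∧ z 3 * z 4 = -(μ * deriv V (π / 2)) ∨
        sin (z 0) * z 3 = (1 + cos (z 0)) * z 4 ∧
          z 4 ^ 2 * (1 - cos (z 0)) = -(μ * deriv V (z 0) * sin (z 0) ^ 3)) := by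
  have hs := sin_pos_of_mem_Ioo hz
  have h := sin_sq_add_cos_sq (z 0)
  have hc : 0 < 1 - cos (z 0) := by nlinarith
  rw [redField_eq hμ.ne' hs.ne' hV]
  constructor
  · intro e
    have e0 := congrFun e 0
    have e1 := congrFun e 1
    have e2 := congrFun e 2
    have e3 := congrFun e 3
    have e4 := congrFun e 4
    simp [hμ.ne'] at e0 e1 e2 e3 e4
    have hz2 : z 2 = 2 * z 1 := by linarith
    have hz1 : z 1 = 0 := by
      rw [hz2] at e3 e4
      generalize cos (z 0) = C at *
      generalize sin (z 0) = S at *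
      field_simp at e3 e4
      -- With `m₁ = 2p` and `p ≠ 0`, the last two components give `S m₂ = 2 C m₃`, and then `S² m₃ =
      -- 2 S² m₃`.
      by_contra hne
      have e4' : S * z 3 = 2 * C * z 4 := by
        apply mul_left_cancel₀ hne; linear_combination e4
      have e3' : z 4 * S ^ 2 = -2 * C * S * z 3 + 2 * (1 + C ^ 2) * z 4 := by
        apply mul_left_cancel₀ hne; linear_combination e3
      have : S ^ 2 * z 4 = 0 := by linear_combination -e3' + 2 * C * e4' + 2 * z 4 * h
      exact (by positivity : S ^ 2 * z 4 ≠ 0) this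
    refine ⟨hz1, by rw [hz2, hz1, mul_zero], ?_⟩
    by_cases hc0 : cos (z 0) = 0
    · have hq : z 0 = π / 2 := by
        refine injOn_cos ⟨hz.1.le, hz.2.le⟩ ⟨by positivity, by linarith [pi_pos]⟩ ?_
        rw [hc0, cos_pi_div_two]
      left
      refine ⟨hq, ?_⟩
      rw [hq] at e1
      simp at e1
      field_simp at e1
      linarith
    · right
      generalize cos (z 0) = C at *
      generalize sin (z 0) = S at *
      generalize deriv V (z 0) = v at *
      field_simp at e1 e2
      -- After division by `C`, the `m₁'` equation is `S (m₃² - m₂²) + 2 C m₂ m₃ = 0`; it factors by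
      -- `S² = (1 - C) (1 + C)`.
      have hm : (S * z 3 - (1 + C) * z 4) * (S * z 3 + (1 - C) * z 4) = 0 := by
        grind
      have hm1 : S * z 3 = (1 + C) * z 4 := by
        rcases mul_eq_zero.1 hm with h5 | h5
        · linarith
        · have : 0 < S * z 3 + (1 - C) * z 4 := by positivity
          linarith
      refine ⟨hm1, ?_⟩
      grind
  · rintro ⟨hz1, hz2, ⟨hq, e⟩ | ⟨e1, e2⟩⟩
    · apply red_ext <;> simp [hz1, hz2, hq]
      rw [e]; field_simp; ring
    · apply red_ext <;> simp [hz1, hz2]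
      · generalize cos (z 0) = C at *
        generalize sin (z 0) = S at *
        generalize deriv V (z 0) = v at *
        field_simp
        grind
      · left
        generalize cos (z 0) = C at *
        generalize sin (z 0) = S at *
        field_simp
        grind

end EqualMasses

/-! ### The two branches of equilibria -/

/-- The isosceles relative equilibrium with separation `π / 2 + s`, in the reduced phase space. -/
noncomputable def isoscelesBranch (μ : ℝ) (V : ℝ → ℝ) (s : ℝ) : Red :=
  ![π / 2 + s, 0, 0,
    μ * sin (π / 2 + s) * (1 + cos (π / 2 + s)) *
      √(-coupling μ V (π / 2 + s) / (1 - cos (π / 2 + s))),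
    μ * sin (π / 2 + s) ^ 2 * √(-coupling μ V (π / 2 + s) / (1 - cos (π / 2 + s)))]

/-- The right-angled relative equilibrium with `θ₁ = π / 4 + s`, in the reduced phase space. -/
noncomputable def rightAngledBranch (μ : ℝ) (V : ℝ → ℝ) (s : ℝ) : Red :=
  ![π / 2, 0, 0, μ * √(-coupling μ V (π / 2) * tan (π / 4 + s)),
    μ * √(-coupling μ V (π / 2) * tan (π / 4 - s))]

theorem mul_sqrt_eq {m x y : ℝ} (hm : 0 < m) (hy : 0 < y) (h : m ^ 2 * x = y ^ 2) :
    m * √x = y := by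
  have : x = (y / m) ^ 2 := by rw [div_pow, ← h]; field_simp
  rw [this, sqrt_sq (by positivity)]
  field_simp

section Branches

variable {μ : ℝ} {V : ℝ → ℝ}

theorem pi_div_two_add_mem {s : ℝ} (hs : s ∈ Ioo (-(π / 2)) (π / 2)) : π / 2 + s ∈ Ioo 0 π :=
  ⟨by linarith [hs.1], by linarith [hs.2]⟩

theorem one_sub_cos_pos {q : ℝ} (hq : q ∈ Ioo 0 π) : 0 < 1 - cos q := by
  have := cos_lt_cos_of_nonneg_of_le_pi le_rfl hq.2.le hq.1
  rw [cos_zero] at this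
  linarith

theorem reduced_isoscelesRotation (hμ : 0 < μ) (hV' : ∀ q ∈ Ioo 0 π, deriv V q < 0) {s : ℝ}
    (hs : s ∈ Ioo (-(π / 2)) (π / 2)) :
    (isoscelesRotation (coupling μ V (π / 2 + s)) (π / 2 + s)).reduced μ μ =
      isoscelesBranch μ V s := by
  have hq := pi_div_two_add_mem hs
  rw [(isBalanced_isoscelesRotation hq (coupling_neg hμ hV' hq)).reduced μ,
    isoscelesRotation_q hq, isoscelesBranch]
  apply red_ext <;> simp
  ring

theorem reduced_rightAngledRotation (hμ : 0 < μ) (hV' : ∀ q ∈ Ioo 0 π, deriv V q < 0) {s : ℝ}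
    (hs : s ∈ Ioo (-(π / 4)) (π / 4)) :
    (rightAngledRotation (coupling μ V (π / 2)) s).reduced μ μ = rightAngledBranch μ V s := by
  rw [(isBalanced_rightAngledRotation (coupling_neg hμ hV' pi_div_two_mem) hs).reduced μ,
    rightAngledRotation_q, rightAngledBranch]
  apply red_ext <;> simp

theorem isoscelesBranch_zero :
    isoscelesBranch μ V 0 =
      ![π / 2, 0, 0, μ * √(-coupling μ V (π / 2)), μ * √(-coupling μ V (π / 2))] := by
  simp [isoscelesBranch]

theorem rightAngledBranch_zero : rightAngledBranch μ V 0 = isoscelesBranch μ V 0 := by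
  simp [isoscelesBranch, rightAngledBranch]

/-- The branch parameters are recovered from the point: `s = q - π / 2` on the isosceles branch, and
`s = arctan (m₂ / m₃) - π / 4` on the right-angled one, where `m₂ / m₃ = tan (π / 4 + s)`. -/
theorem redField_eq_zero_iff_mem_branches (hμ : 0 < μ) (hV : ContDiffOn ℝ ∞ V (Ioo 0 π))
    (hV' : ∀ q ∈ Ioo 0 π, deriv V q < 0) {r : ℝ} (hr : r ∈ Ioc 0 (π / 4)) {z : Red}
    (h0 : z 0 ∈ Ioo (π / 2 - r) (π / 2 + r)) (h3 : 0 < z 3) (h4 : 0 < z 4)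
    (hz : arctan (z 3 / z 4) ∈ Ioo (π / 4 - r) (π / 4 + r)) :
    redField μ μ V z = 0 ↔
      z ∈ isoscelesBranch μ V '' Ioo (-r) r ∪ rightAngledBranch μ V '' Ioo (-r) r := by
  have hq : z 0 ∈ Ioo 0 π := ⟨by linarith [h0.1, hr.2, pi_pos], by linarith [h0.2, hr.2, pi_pos]⟩
  have hs := sin_pos_of_mem_Ioo hq
  have hc := one_sub_cos_pos hq
  have hsc := sin_sq_add_cos_sq (z 0)
  rw [redField_eq_zero_iff hμ hq (differentiableAt_potential hV _ hq) h3 h4]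
  constructor
  · rintro ⟨h1, h2, ⟨e0, e⟩ | ⟨e1, e2⟩⟩
    · right
      have hsr : arctan (z 3 / z 4) - π / 4 ∈ Ioo (-r) r :=
        ⟨by linarith [hz.1], by linarith [hz.2]⟩
      refine ⟨arctan (z 3 / z 4) - π / 4, hsr, ?_⟩
      have t1 : tan (π / 4 + (arctan (z 3 / z 4) - π / 4)) = z 3 / z 4 := by
        rw [add_sub_cancel, tan_arctan]
      have t2 : tan (π / 4 - (arctan (z 3 / z 4) - π / 4)) = z 4 / z 3 := by
        rw [show π / 4 - (arctan (z 3 / z 4) - π / 4) = π / 2 - arctan (z 3 / z 4) by ring,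
          tan_pi_div_two_sub, tan_arctan, inv_div]
      have hk : deriv V (π / 2) = -(z 3 * z 4) / μ := by
        rw [e]; field_simp
      rw [rightAngledBranch, t1, t2]
      apply red_ext
      · exact e0.symm
      · exact h1.symm
      · exact h2.symm
      · apply mul_sqrt_eq hμ h3
        rw [coupling_pi_div_two, hk]
        field_simp
      · apply mul_sqrt_eq hμ h4
        rw [coupling_pi_div_two, hk]
        field_simp
    · left
      refine ⟨z 0 - π / 2, ⟨by linarith [h0.1], by linarith [h0.2]⟩, ?_⟩
      have hk : deriv V (z 0) = -(z 4 ^ 2 * (1 - cos (z 0))) / (μ * sin (z 0) ^ 3) := by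
        rw [e2]; field_simp
      rw [isoscelesBranch, add_sub_cancel]
      have hb : μ * sin (z 0) ^ 2 * √(-coupling μ V (z 0) / (1 - cos (z 0))) = z 4 := by
        apply mul_sqrt_eq (by positivity) h4
        rw [coupling, hk]
        field_simp
      apply red_ext
      · rfl
      · exact h1.symm
      · exact h2.symm
      · change μ * sin (z 0) * (1 + cos (z 0)) * _ = z 3
        apply mul_left_cancel₀ hs.ne'
        rw [e1, ← hb]
        ring
      · exact hb
  · rintro (⟨s, hsr, rfl⟩ | ⟨s, hsr, rfl⟩)
    · refine ⟨rfl, rfl, Or.inr ⟨?_, ?_⟩⟩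
      · simp only [isoscelesBranch, cons_val]
        ring
      · have hκ := coupling_neg hμ hV' hq
        simp only [isoscelesBranch, cons_val] at hs hc hκ ⊢
        rw [mul_pow, sq_sqrt (div_nonneg (by linarith) hc.le), coupling]
        generalize π / 2 + s = q at *
        field_simp
    · refine ⟨rfl, rfl, Or.inl ⟨rfl, ?_⟩⟩
      have hκ := coupling_neg hμ hV' pi_div_two_mem
      obtain ⟨p1, p2, p3⟩ := tan_pi_div_four_add_mul (s := s)
        ⟨by linarith [hsr.1, hr.2], by linarith [hsr.2, hr.2]⟩
      simp only [rightAngledBranch, cons_val]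
      rw [mul_mul_mul_comm, ← sqrt_mul (mul_nonneg (by linarith) p1.le), mul_mul_mul_comm, p3,
        mul_one, sqrt_mul_self (by linarith), coupling_pi_div_two]
      field_simp

theorem eventually_redField_eq_zero_iff (hμ : 0 < μ) (hV : ContDiffOn ℝ ∞ V (Ioo 0 π))
    (hV' : ∀ q ∈ Ioo 0 π, deriv V q < 0) {r : ℝ} (hr : r ∈ Ioc 0 (π / 4)) :
    ∀ᶠ z in 𝓝 (isoscelesBranch μ V 0), redField μ μ V z = 0 ↔
      z ∈ isoscelesBranch μ V '' Ioo (-r) r ∪ rightAngledBranch μ V '' Ioo (-r) r := by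
  have hκ := coupling_neg hμ hV' pi_div_two_mem
  have hb : 0 < μ * √(-coupling μ V (π / 2)) := mul_pos hμ (sqrt_pos.2 (by linarith))
  have hc (i : Fin 5) : ContinuousAt (fun z : Red => z i) (isoscelesBranch μ V 0) :=
    (continuous_apply i).continuousAt
  have e3 : isoscelesBranch μ V 0 3 = μ * √(-coupling μ V (π / 2)) := by
    rw [isoscelesBranch_zero]; rfl
  have e4 : isoscelesBranch μ V 0 4 = μ * √(-coupling μ V (π / 2)) := by
    rw [isoscelesBranch_zero]; rfl
  have e0 : isoscelesBranch μ V 0 0 = π / 2 := by rw [isoscelesBranch_zero]; rfl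
  have hq : ContinuousAt (fun z : Red => arctan (z 3 / z 4)) (isoscelesBranch μ V 0) :=
    continuous_arctan.continuousAt.comp ((hc 3).div (hc 4) (e4 ▸ hb.ne'))
  filter_upwards [(hc 0).eventually (Ioo_mem_nhds (a := π / 2 - r) (b := π / 2 + r)
      (by simp only [e0]; linarith [hr.1]) (by simp only [e0]; linarith [hr.1])),
    (hc 3).eventually (lt_mem_nhds (e3 ▸ hb)), (hc 4).eventually (lt_mem_nhds (e4 ▸ hb)),
    hq.eventually (Ioo_mem_nhds (a := π / 4 - r) (b := π / 4 + r)
      (by simp only [e3, e4, div_self hb.ne', arctan_one]; linarith [hr.1])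
      (by simp only [e3, e4, div_self hb.ne', arctan_one]; linarith [hr.1]))] with z h0 h3 h4 hz
  exact redField_eq_zero_iff_mem_branches hμ hV hV' hr h0 h3 h4 hz

theorem eventually_symmetric (hμ : 0 < μ) (hV : ContDiffOn ℝ ∞ V (Ioo 0 π)) :
    ∀ᶠ z in 𝓝 (isoscelesBranch μ V 0), fderiv ℝ casimir z (redField μ μ V z) = 0 ∧
      mirrorSwap (mirrorSwap z) = z ∧ casimir (mirrorSwap z) = casimir z ∧
      redField μ μ V (mirrorSwap z) = fderiv ℝ mirrorSwap z (redField μ μ V z) := by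
  have e0 : isoscelesBranch μ V 0 0 = π / 2 := by rw [isoscelesBranch_zero]; rfl
  have hc : ContinuousAt (fun z : Red => z 0) (isoscelesBranch μ V 0) :=
    (continuous_apply 0).continuousAt
  filter_upwards [hc.eventually (Ioo_mem_nhds (a := 0) (b := π)
    (by simp only [e0, pi_div_two_mem.1]) (by simp only [e0, pi_div_two_mem.2]))] with z hz
  exact ⟨fderiv_casimir_redField _ _ _ _, mirrorSwap_mirrorSwap z, casimir_mirrorSwap z,
    redField_mirrorSwap hμ.ne' (sin_pos_of_mem_Ioo hz).ne' (differentiableAt_potential hV _ hz)⟩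

theorem mirrorSwap_isoscelesBranch (s : ℝ) :
    mirrorSwap (isoscelesBranch μ V s) = isoscelesBranch μ V s := by
  have h := sin_sq_add_cos_sq (π / 2 + s)
  simp only [isoscelesBranch]
  generalize √(-coupling μ V (π / 2 + s) / (1 - cos (π / 2 + s))) = b
  apply red_ext
  · rfl
  · simp [mirrorSwap]
  · simp [mirrorSwap]
  · simp only [mirrorSwap, cons_val]
    linear_combination (μ * sin (π / 2 + s) * b) * h
  · simp only [mirrorSwap, cons_val]
    ring

theorem mirrorSwap_rightAngledBranch (s : ℝ) :
    mirrorSwap (rightAngledBranch μ V s) = rightAngledBranch μ V (-s) := by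
  apply red_ext <;> simp [mirrorSwap, rightAngledBranch, sub_eq_add_neg]

/-! ### Smoothness of the branches -/

theorem contDiffOn_deriv (hV : ContDiffOn ℝ ∞ V (Ioo 0 π)) : ContDiffOn ℝ ∞ (deriv V) (Ioo 0 π) :=
  hV.deriv_of_isOpen isOpen_Ioo (by simp)

theorem contDiffOn_isoscelesBranch (hμ : 0 < μ) (hV : ContDiffOn ℝ ∞ V (Ioo 0 π))
    (hV' : ∀ q ∈ Ioo 0 π, deriv V q < 0) :
    ContDiffOn ℝ ∞ (isoscelesBranch μ V) (Ioo (-(π / 4)) (π / 4)) := by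
  have hsin : ContDiffOn ℝ ∞ sin (Ioo 0 π) := contDiff_sin.contDiffOn
  have hcos : ContDiffOn ℝ ∞ cos (Ioo 0 π) := contDiff_cos.contDiffOn
  have hk : ContDiffOn ℝ ∞ (coupling μ V) (Ioo 0 π) :=
    (contDiffOn_deriv hV).div (contDiffOn_const.mul hsin) fun q hq =>
      (mul_pos hμ (sin_pos_of_mem_Ioo hq)).ne'
  have hb : ContDiffOn ℝ ∞ (fun q => √(-coupling μ V q / (1 - cos q))) (Ioo 0 π) := by
    refine (hk.neg.div (contDiffOn_const.sub hcos) fun q hq => (one_sub_cos_pos hq).ne').sqrt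
      fun q hq => (div_pos ?_ (one_sub_cos_pos hq)).ne'
    have := coupling_neg hμ hV' hq
    simpa using this
  have hs : ContDiffOn ℝ ∞ (fun s : ℝ => π / 2 + s) (Ioo (-(π / 4)) (π / 4)) :=
    (contDiff_const.add contDiff_id).contDiffOn
  have hm : MapsTo (fun s : ℝ => π / 2 + s) (Ioo (-(π / 4)) (π / 4)) (Ioo 0 π) := fun s hs =>
    pi_div_two_add_mem ⟨by linarith [hs.1, pi_pos], by linarith [hs.2, pi_pos]⟩
  rw [contDiffOn_pi]
  intro i
  fin_cases i
  · exact hs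
  · exact contDiffOn_const
  · exact contDiffOn_const
  · exact (((contDiffOn_const.mul hsin).mul (contDiffOn_const.add hcos)).mul hb).comp hs hm
  · exact ((contDiffOn_const.mul (hsin.pow 2)).mul hb).comp hs hm

theorem contDiffOn_rightAngledBranch (hμ : 0 < μ) (hV' : ∀ q ∈ Ioo 0 π, deriv V q < 0) :
    ContDiffOn ℝ ∞ (rightAngledBranch μ V) (Ioo (-(π / 4)) (π / 4)) := by
  have hκ := coupling_neg hμ hV' pi_div_two_mem
  have h : ContDiffOn ℝ ∞ (fun t => μ * √(-coupling μ V (π / 2) * tan t)) (Ioo 0 (π / 2)) := by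
    refine contDiffOn_const.mul ((contDiffOn_const.mul fun t ht => ?_).sqrt fun t ht => ?_)
    · exact (contDiffAt_tan.2 (cos_pos_of_mem_Ioo
        ⟨by linarith [ht.1, pi_pos], ht.2⟩).ne').contDiffWithinAt
    · exact (mul_pos (by linarith) (tan_pos_of_pos_of_lt_pi_div_two ht.1 ht.2)).ne'
  rw [contDiffOn_pi]
  intro i
  fin_cases i
  · exact contDiffOn_const
  · exact contDiffOn_const
  · exact contDiffOn_const
  · exact h.comp (contDiff_const.add contDiff_id).contDiffOn
      fun s hs => ⟨show 0 < π / 4 + s by linarith [hs.1], show π / 4 + s < π / 2 by linarith [hs.2]⟩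
  · exact h.comp (contDiff_const.sub contDiff_id).contDiffOn
      fun s hs => ⟨show 0 < π / 4 - s by linarith [hs.2], show π / 4 - s < π / 2 by linarith [hs.1]⟩

/-! ### Derivatives at the crossing -/

/-- The isosceles branch moves `q` at unit speed, while the right-angled branch keeps `q` fixed and
moves `m₂`. -/
theorem linearIndependent_deriv_branches (hμ : 0 < μ) (hV : ContDiffOn ℝ ∞ V (Ioo 0 π))
    (hV' : ∀ q ∈ Ioo 0 π, deriv V q < 0) :
    LinearIndependent ℝ ![deriv (isoscelesBranch μ V) 0, deriv (rightAngledBranch μ V) 0] := by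
  have hκ := coupling_neg hμ hV' pi_div_two_mem
  have hn : Ioo (-(π / 4)) (π / 4) ∈ 𝓝 (0 : ℝ) := Ioo_mem_nhds (by linarith [pi_pos]) (by positivity)
  have h1 := ((contDiffOn_isoscelesBranch hμ hV hV').contDiffAt hn).differentiableAt (by simp)
  have h2 := ((contDiffOn_rightAngledBranch (V := V) hμ hV').contDiffAt hn).differentiableAt
    (by simp)
  have a0 : deriv (isoscelesBranch μ V) 0 0 = 1 := by
    rw [deriv_pi fun i => differentiableAt_pi.1 h1 i]
    exact ((hasDerivAt_id (0 : ℝ)).const_add (π / 2)).deriv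
  have b0 : deriv (rightAngledBranch μ V) 0 0 = 0 := by
    rw [deriv_pi fun i => differentiableAt_pi.1 h2 i]
    exact deriv_const _ _
  have b3 : deriv (rightAngledBranch μ V) 0 3 ≠ 0 := by
    rw [deriv_pi fun i => differentiableAt_pi.1 h2 i]
    have ht : HasDerivAt (fun s => tan (π / 4 + s)) 2 0 := by
      have hc : cos (π / 4) ≠ 0 := by rw [cos_pi_div_four]; positivity
      have := (hasDerivAt_tan hc)
      rw [cos_pi_div_four, div_pow, sq_sqrt (by norm_num)] at this
      refine (HasDerivAt.comp_const_add (π / 4) 0 (by rwa [add_zero])).congr_deriv (by norm_num)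
    have h4 := ((ht.const_mul (-coupling μ V (π / 2))).sqrt (by
      rw [add_zero, tan_pi_div_four]; linarith)).const_mul μ
    have h5 : deriv (fun s => rightAngledBranch μ V s 3) 0 = _ := h4.deriv
    beta_reduce
    rw [h5, add_zero, tan_pi_div_four]
    have : 0 < √(-coupling μ V (π / 2) * 1) := sqrt_pos.2 (by linarith)
    exact (mul_pos hμ (div_pos (by linarith) (by positivity))).ne'
  rw [LinearIndependent.pair_iff]
  intro s t hst
  have c0 := congrFun hst 0
  have c3 := congrFun hst 3
  simp only [Pi.add_apply, Pi.smul_apply, Pi.zero_apply, smul_eq_mul, a0, b0] at c0 c3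
  have hs : s = 0 := by linarith
  rw [hs, zero_mul, zero_add] at c3
  exact ⟨hs, (mul_eq_zero.1 c3).resolve_right b3⟩

theorem tan_add_tan_eq {s : ℝ} (hs : s ∈ Ioo (-(π / 4)) (π / 4)) :
    tan (π / 4 + s) + tan (π / 4 - s) = 2 / cos (2 * s) := by
  have h1 : 0 < cos (π / 4 + s) := cos_pos_of_mem_Ioo
    ⟨by linarith [hs.1, pi_pos], by linarith [hs.2]⟩
  have h2 : 0 < cos (π / 4 - s) := cos_pos_of_mem_Ioo
    ⟨by linarith [hs.2, pi_pos], by linarith [hs.1]⟩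
  have h3 : sin (π / 4 + s) * cos (π / 4 - s) + cos (π / 4 + s) * sin (π / 4 - s) = 1 := by
    rw [← sin_add, show π / 4 + s + (π / 4 - s) = π / 2 by ring, sin_pi_div_two]
  have h4 : cos (2 * s) = 2 * (cos (π / 4 + s) * cos (π / 4 - s)) := by
    have e1 := cos_add (π / 4 + s) (π / 4 - s)
    have e2 := cos_sub (π / 4 + s) (π / 4 - s)
    rw [show π / 4 + s + (π / 4 - s) = π / 2 by ring, cos_pi_div_two] at e1
    rw [show π / 4 + s - (π / 4 - s) = 2 * s by ring] at e2
    linarith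
  rw [tan_eq_sin_div_cos, tan_eq_sin_div_cos, h4, div_add_div _ _ h1.ne' h2.ne', h3]
  field_simp

theorem casimir_rightAngledBranch (hμ : 0 < μ) (hV' : ∀ q ∈ Ioo 0 π, deriv V q < 0) {s : ℝ}
    (hs : s ∈ Ioo (-(π / 4)) (π / 4)) :
    casimir (rightAngledBranch μ V s) = -2 * μ * deriv V (π / 2) / cos (2 * s) := by
  have hκ := coupling_neg hμ hV' pi_div_two_mem
  obtain ⟨p1, p2, -⟩ := tan_pi_div_four_add_mul hs
  have e := tan_add_tan_eq hs
  simp only [casimir, rightAngledBranch, cons_val]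
  rw [mul_pow, mul_pow, sq_sqrt (mul_nonneg (by linarith) p1.le),
    sq_sqrt (mul_nonneg (by linarith) p2.le), coupling_pi_div_two]
  have : μ ^ 2 * (-(deriv V (π / 2) / μ)) = -(μ * deriv V (π / 2)) := by field_simp
  linear_combination (-(μ * deriv V (π / 2))) * e +
    (tan (π / 4 + s) + tan (π / 4 - s)) * this

theorem casimir_isoscelesBranch (hμ : 0 < μ) (hV' : ∀ q ∈ Ioo 0 π, deriv V q < 0) {s : ℝ}
    (hs : s ∈ Ioo (-(π / 2)) (π / 2)) :
    casimir (isoscelesBranch μ V s) = -2 * μ * (deriv V (π / 2 + s) *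
      (sin (π / 2 + s) * (1 + cos (π / 2 + s)) / (1 - cos (π / 2 + s)))) := by
  have hq := pi_div_two_add_mem hs
  have hκ := coupling_neg hμ hV' hq
  have hc := one_sub_cos_pos hq
  have hsin := sin_pos_of_mem_Ioo hq
  have h := sin_sq_add_cos_sq (π / 2 + s)
  simp only [casimir, isoscelesBranch, cons_val]
  rw [mul_pow, mul_pow _ √_, sq_sqrt (div_nonneg (by linarith) hc.le), coupling]
  generalize π / 2 + s = q at *
  generalize cos q = C at *
  generalize sin q = S at *
  field_simp
  linear_combination (-(μ * S * deriv V q)) * h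

/-- The geometric factor `sin q (1 + cos q) / (1 - cos q)` has value `1` and derivative `-2` at `π /
2`, hence the critical ratio `V'' = 2V'`. -/
theorem deriv_casimir_isoscelesBranch (hμ : 0 < μ) (hV : ContDiffOn ℝ ∞ V (Ioo 0 π))
    (hV' : ∀ q ∈ Ioo 0 π, deriv V q < 0) :
    deriv (fun s => casimir (isoscelesBranch μ V s)) 0 =
      -2 * μ * (iteratedDeriv 2 V (π / 2) - 2 * deriv V (π / 2)) := by
  have hn : Ioo (-(π / 2)) (π / 2) ∈ 𝓝 (0 : ℝ) := Ioo_mem_nhds (by linarith [pi_pos]) (by positivity)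
  have he : (fun s => casimir (isoscelesBranch μ V s)) =ᶠ[𝓝 0] _ :=
    eventually_of_mem hn fun s hs => casimir_isoscelesBranch hμ hV' hs
  have h1 : HasDerivAt (deriv V) (iteratedDeriv 2 V (π / 2)) (π / 2) := by
    rw [iteratedDeriv_succ, iteratedDeriv_one]
    exact (((contDiffOn_deriv hV).contDiffAt (Ioo_mem_nhds pi_div_two_mem.1
      pi_div_two_mem.2)).differentiableAt (by simp)).hasDerivAt
  have h2 := (h1.mul (((hasDerivAt_sin (π / 2)).mul ((hasDerivAt_cos (π / 2)).const_add 1)).div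
    ((hasDerivAt_cos (π / 2)).const_sub 1) (by simp))).const_mul (-2 * μ)
  rw [he.deriv_eq]
  refine (HasDerivAt.comp_const_add (π / 2) 0 (by rw [add_zero]; exact h2)).deriv.trans ?_
  simp
  left
  ring

theorem deriv_casimir_rightAngledBranch (hμ : 0 < μ) (hV' : ∀ q ∈ Ioo 0 π, deriv V q < 0) :
    deriv (fun s => casimir (rightAngledBranch μ V s)) 0 = 0 ∧
      0 < iteratedDeriv 2 (fun s => casimir (rightAngledBranch μ V s)) 0 := by
  have hn : Ioo (-(π / 4)) (π / 4) ∈ 𝓝 (0 : ℝ) := Ioo_mem_nhds (by linarith [pi_pos]) (by positivity)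
  set K := -2 * μ * deriv V (π / 2) with hK
  have hKp : 0 < K := by nlinarith [mul_neg_of_pos_of_neg hμ (hV' _ pi_div_two_mem)]
  have he : (fun s => casimir (rightAngledBranch μ V s)) =ᶠ[𝓝 0] fun s => K / cos (2 * s) :=
    eventually_of_mem hn fun s hs => casimir_rightAngledBranch hμ hV' hs
  have hlin (s : ℝ) : HasDerivAt (fun s : ℝ => 2 * s) 2 s := by
    simpa using (hasDerivAt_id s).const_mul 2
  have hd : deriv (fun s => K / cos (2 * s)) =ᶠ[𝓝 0]
      fun s => K * (2 * sin (2 * s)) / cos (2 * s) ^ 2 := by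
    refine eventually_of_mem hn fun s hs => ?_
    have hc : cos (2 * s) ≠ 0 :=
      (cos_pos_of_mem_Ioo ⟨by linarith [hs.1], by linarith [hs.2]⟩).ne'
    refine (((hasDerivAt_const s K).div (hlin s).cos hc)).deriv.trans ?_
    congr 1
    ring
  constructor
  · rw [he.deriv_eq, hd.self_of_nhds]
    simp
  · rw [iteratedDeriv_succ, iteratedDeriv_one, he.deriv.deriv_eq, hd.deriv_eq]
    have h := ((((hlin 0).sin.const_mul 2).const_mul K).div ((hlin 0).cos.pow 2) (by simp)).deriv
    have h' : deriv (fun s => K * (2 * sin (2 * s)) / cos (2 * s) ^ 2) 0 = _ := h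
    rw [h']
    simp
    exact hKp

theorem isSymmetricCrossing_branches (hμ : 0 < μ) (hV : ContDiffOn ℝ ∞ V (Ioo 0 π))
    (hV' : ∀ q ∈ Ioo 0 π, deriv V q < 0) :
    IsSymmetricCrossing (redField μ μ V) casimir mirrorSwap (isoscelesBranch μ V)
      (rightAngledBranch μ V) :=
  ⟨rightAngledBranch_zero.symm, eventually_symmetric hμ hV,
    -- For `|s| < π / 4` both `π / 4 ± s` lie in `(0, π / 2)`, so the tangents under the roots are
    -- positive.
    ⟨π / 4, by positivity, contDiffOn_isoscelesBranch hμ hV hV',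
      contDiffOn_rightAngledBranch hμ hV',
      fun s _ => ⟨mirrorSwap_isoscelesBranch s, mirrorSwap_rightAngledBranch s⟩,
      fun _ hr => eventually_redField_eq_zero_iff hμ hV hV' hr⟩,
    linearIndependent_deriv_branches hμ hV hV',
    deriv_casimir_rightAngledBranch hμ hV'⟩

theorem isPitchfork_branches_iff (hμ : 0 < μ) (hV : ContDiffOn ℝ ∞ V (Ioo 0 π))
    (hV' : ∀ q ∈ Ioo 0 π, deriv V q < 0) :
    IsPitchfork (redField μ μ V) casimir mirrorSwap (isoscelesBranch μ V)
      (rightAngledBranch μ V) ↔ iteratedDeriv 2 V (π / 2) ≠ 2 * deriv V (π / 2) := by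
  rw [IsPitchfork, and_iff_right (isSymmetricCrossing_branches hμ hV hV'),
    deriv_casimir_isoscelesBranch hμ hV hV', mul_ne_zero_iff, sub_ne_zero, and_iff_right]
  exact mul_ne_zero (by norm_num) hμ.ne'

end Branches

/-! ### Linearization of the reduced equations -/

theorem IsBalanced.redField_reduced_eq_zero {κ a b μ : ℝ} {V : ℝ → ℝ} {d : Rotation}
    (h : IsBalanced κ d a b) (hμ : 0 < μ) (hV : DifferentiableAt ℝ V d.q)
    (hκ : κ = deriv V d.q / (μ * sin d.q)) : redField μ μ V (d.reduced μ μ) = 0 := by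
  have hs : 0 < sin d.q := sin_pos_of_mem_Ioo h.q_mem
  have hsc := sin_sq_add_cos_sq d.q
  have h1 := h.first
  have h2 := h.second
  rw [eq_div_iff (by positivity)] at hκ
  have e0 : d.reduced μ μ 0 = d.q := rfl
  rw [redField_eq (z := d.reduced μ μ) hμ.ne' (by rw [e0]; exact hs.ne') (by rwa [e0]), h.reduced]
  have hab : cos d.q * (a ^ 2 - b ^ 2) = 0 := by linear_combination h2 - h1
  simp only [cons_val]
  generalize deriv V d.q = v at *
  generalize cos d.q = C at *
  generalize sin d.q = S at *
  apply red_ext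
  · simp
  · simp only [cons_val, Pi.zero_apply]
    rw [← hκ, ← h2]
    field_simp
    ring
  · simp only [cons_val, Pi.zero_apply]
    have e : (C / S * ((-(μ * S ^ 2 * a)) ^ 2 - (μ * S * (b - a * C)) ^ 2) +
        2 * (C / S) ^ 2 * (μ * S * (b - a * C)) * -(μ * S ^ 2 * a)) / μ =
        μ * S * (C * (a ^ 2 * (S ^ 2 + C ^ 2) - b ^ 2)) := by
      field_simp
      ring
    rw [e, hsc, mul_one, hab, mul_zero]
  · simp
  · simp

section Field

variable {μ : ℝ} {V : ℝ → ℝ}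

/-- The linearization of the reduced vector field at a point with `p = m₁ = 0`. -/
theorem fderiv_redField {z : Red} (hμ : μ ≠ 0) (hz : z 0 ∈ Ioo 0 π)
    (hV : ContDiffOn ℝ ∞ V (Ioo 0 π)) (h1 : z 1 = 0) (h2 : z 2 = 0) (w : Red) :
    fderiv ℝ (redField μ μ V) z w =
      ![(2 * w 1 - w 2) / μ,
        -((w 3 * z 4 + z 3 * w 4) / sin (z 0) ^ 2 - 2 * cos (z 0) / sin (z 0) ^ 3 * z 3 * z 4 * w 0
          - 4 * cos (z 0) / sin (z 0) ^ 3 * z 4 * w 4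
          + (2 / sin (z 0) ^ 2 + 6 * cos (z 0) ^ 2 / sin (z 0) ^ 4) * z 4 ^ 2 * w 0) / μ
          - deriv (deriv V) (z 0) * w 0,
        (-(z 4 ^ 2 - z 3 ^ 2) / sin (z 0) ^ 2 * w 0
          + 2 * (cos (z 0) / sin (z 0)) * (z 4 * w 4 - z 3 * w 3)
          - 4 * cos (z 0) / sin (z 0) ^ 3 * z 3 * z 4 * w 0
          + 2 * (cos (z 0) / sin (z 0)) ^ 2 * (w 3 * z 4 + z 3 * w 4)) / μ,
        (z 4 * (w 2 - w 1) - w 2 * (-(cos (z 0) / sin (z 0) * z 3)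
          + (1 + cos (z 0) ^ 2) / sin (z 0) ^ 2 * z 4)) / μ,
        (w 2 * (z 3 - cos (z 0) / sin (z 0) * z 4) - z 3 * (w 2 - w 1)) / μ] := by
  have hs := sin_pos_of_mem_Ioo hz
  have hsc := sin_sq_add_cos_sq (z 0)
  have he : redField μ μ V =ᶠ[𝓝 z] fun y =>
      ![(2 * y 1 - y 2) / μ,
        -((y 3 * y 4 / sin (y 0) ^ 2 - 2 * cos (y 0) / sin (y 0) ^ 3 * y 4 ^ 2) / μ
          + deriv V (y 0)),
        (cos (y 0) / sin (y 0) * (y 4 ^ 2 - y 3 ^ 2)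
          + 2 * (cos (y 0) / sin (y 0)) ^ 2 * y 3 * y 4) / μ,
        (y 4 * (y 2 - y 1) - y 2 * (-(cos (y 0) / sin (y 0) * y 3)
          + (1 + cos (y 0) ^ 2) / sin (y 0) ^ 2 * y 4)) / μ,
        (y 2 * (y 3 - cos (y 0) / sin (y 0) * y 4) - y 3 * (y 2 - y 1)) / μ] := by
    filter_upwards [(continuous_apply (A := fun _ : Fin 5 => ℝ) 0).continuousAt.eventually
      (Ioo_mem_nhds hz.1 hz.2)] with y hy
    exact redField_eq hμ (sin_pos_of_mem_Ioo hy).ne' (differentiableAt_potential hV _ hy)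
  rw [he.fderiv_eq]
  have h (i : Fin 5) : HasFDerivAt (fun z : Red => z i)
      (ContinuousLinearMap.proj i : Red →L[ℝ] ℝ) z := hasFDerivAt_apply i z
  have dV : HasDerivAt (deriv V) (deriv (deriv V) (z 0)) (z 0) :=
    (((contDiffOn_deriv hV).contDiffAt (Ioo_mem_nhds hz.1 hz.2)).differentiableAt
      (by simp)).hasDerivAt
  have dP : HasDerivAt (fun q => (sin q ^ 2)⁻¹) (-2 * cos (z 0) / sin (z 0) ^ 3) (z 0) := by
    refine (((hasDerivAt_sin (z 0)).pow 2).inv (pow_ne_zero 2 hs.ne')).congr_deriv ?_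
    simp only [Pi.pow_apply]
    field_simp
    norm_num
    ring
  have dR : HasDerivAt (fun q => 2 * cos q / sin q ^ 3)
      (-(2 / sin (z 0) ^ 2 + 6 * cos (z 0) ^ 2 / sin (z 0) ^ 4)) (z 0) := by
    refine (((hasDerivAt_cos (z 0)).const_mul 2).div ((hasDerivAt_sin (z 0)).pow 3)
      (by simpa using hs.ne')).congr_deriv ?_
    simp only [Pi.pow_apply]
    field_simp
    norm_num
    ring
  have fV := dV.comp_hasFDerivAt z (h 0)
  have fP := dP.comp_hasFDerivAt z (h 0)
  have fR := dR.comp_hasFDerivAt z (h 0)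
  have fK := (hasDerivAt_cos_div_sin hs.ne').comp_hasFDerivAt z (h 0)
  have fM := (hasDerivAt_one_add_cos_sq_div hs.ne').comp_hasFDerivAt z (h 0)
  have f34 := (h 3).mul (h 4)
  rw [fderiv_of_components (z := z)
    ((((h 1).const_mul 2).sub (h 2)).mul_const μ⁻¹)
    (((((f34.mul fP).sub (fR.mul ((h 4).pow 2))).mul_const μ⁻¹).add fV).neg)
    (((fK.mul (((h 4).pow 2).sub ((h 3).pow 2))).add
      ((((fK.pow 2).const_mul 2).mul (h 3)).mul (h 4))).mul_const μ⁻¹)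
    ((((h 4).mul ((h 2).sub (h 1))).sub ((h 2).mul ((fK.mul (h 3)).neg.add
      (fM.mul (h 4))))).mul_const μ⁻¹)
    ((((h 2).mul ((h 3).sub (fK.mul (h 4)))).sub ((h 3).mul ((h 2).sub (h 1)))).mul_const μ⁻¹)]
  apply red_ext
  · simp
    field_simp
  · simp
    field_simp
    ring
  · simp
    field_simp
    ring
  · simp [h1, h2]
    field_simp
  · simp [h1, h2]
    field_simp

end Field

/-! ### Criteria for ellipticity and instability -/

theorem leafTangent_casimir (z : Red) :
    leafTangent casimir z = {w | (z 2 : ℂ) * w 2 + z 3 * w 3 + z 4 * w 4 = 0} := by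
  have h (i : Fin 5) : pd i casimir z = fderiv ℝ casimir z (Pi.single i 1) := by
    have hd : DifferentiableAt ℝ casimir z := by unfold casimir; fun_prop
    exact hd.lineDeriv_eq_fderiv
  ext w
  simp only [leafTangent, mem_ofPred_eq, h, fderiv_casimir, Fin.sum_univ_five]
  simp
  constructor <;> intro h
  · linear_combination h / 2
  · linear_combination 2 * h

/-- The conditions on `T, D` say that `l⁴ - T l² + D = (l² + ω₁²) (l² + ω₂²)` with distinct positive
frequencies. The annihilating polynomial then has four distinct nonzero imaginary roots. -/
theorem isEllipticRE_of_quartic {X : Red → Red} {C : Red → ℝ} {z : Red} (hX : X z = 0)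
    (hinv : ∀ w ∈ leafTangent C z, linearization X z *ᵥ w ∈ leafTangent C z) {T D : ℝ}
    (hT : T < 0) (hD : 0 < D) (hTD : 4 * D < T ^ 2)
    (hq : ∀ w ∈ leafTangent C z, linearization X z *ᵥ (linearization X z *ᵥ
      (linearization X z *ᵥ (linearization X z *ᵥ w))) =
        (T : ℂ) • (linearization X z *ᵥ (linearization X z *ᵥ w)) - (D : ℂ) • w) :
    IsEllipticRE X C z := by
  have hr : 0 < √(T ^ 2 - 4 * D) := sqrt_pos.2 (by linarith)
  have hr2 : √(T ^ 2 - 4 * D) ^ 2 = T ^ 2 - 4 * D := sq_sqrt (by linarith)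
  have hrT : √(T ^ 2 - 4 * D) < -T := by nlinarith
  set r := √(T ^ 2 - 4 * D)
  obtain ⟨ω₁, hω₁, e₁⟩ : ∃ ν : ℝ, 0 < ν ∧ ν ^ 2 = (-T + r) / 2 :=
    ⟨√((-T + r) / 2), sqrt_pos.2 (by linarith), sq_sqrt (by linarith)⟩
  obtain ⟨ω₂, hω₂, e₂⟩ : ∃ ν : ℝ, 0 < ν ∧ ν ^ 2 = (-T - r) / 2 :=
    ⟨√((-T - r) / 2), sqrt_pos.2 (by linarith), sq_sqrt (by linarith)⟩
  have hne : ω₁ ^ 2 - ω₂ ^ 2 ≠ 0 := by rw [e₁, e₂]; intro h; linarith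
  have hTe : T = -(ω₁ ^ 2 + ω₂ ^ 2) := by rw [e₁, e₂]; ring
  have hDe : D = ω₁ ^ 2 * ω₂ ^ 2 := by rw [e₁, e₂]; linear_combination (1 / 4) * hr2
  have hadd {v w} (hv : v ∈ leafTangent C z) (hw : w ∈ leafTangent C z) :
      v + w ∈ leafTangent C z := by
    simp only [leafTangent, mem_ofPred_eq, Pi.add_apply, mul_add, Finset.sum_add_distrib] at *
    rw [hv, hw, add_zero]
  have hsmul {v} (c : ℂ) (hv : v ∈ leafTangent C z) : c • v ∈ leafTangent C z := by
    simp only [leafTangent, mem_ofPred_eq, Pi.smul_apply, smul_eq_mul] at *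
    simp only [mul_left_comm _ c, ← Finset.mul_sum, hv, mul_zero]
  set M := linearization X z
  rw [hTe, hDe] at hq
  push_cast at hq
  refine ⟨hX, ?_, ?_⟩
  · rintro l w ⟨hw, hw0, hlw⟩
    have h4 := hq w hw
    change M *ᵥ w = _ at hlw
    simp only [hlw, mulVec_smul, smul_smul, ← sub_smul] at h4
    obtain ⟨i, hi⟩ := Function.ne_iff.1 hw0
    have h5 := mul_right_cancel₀ hi (congrFun h4 i)
    have h6 : (l - Complex.I * ω₁) * (l + Complex.I * ω₁) *
        ((l - Complex.I * ω₂) * (l + Complex.I * ω₂)) = 0 := by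
      linear_combination h5 - (l ^ 2 * (ω₁ ^ 2 + ω₂ ^ 2) +
        (1 - Complex.I ^ 2) * ω₁ ^ 2 * ω₂ ^ 2) * Complex.I_sq
    have key {ν : ℝ} (hν : 0 < ν) (h : l = Complex.I * ν ∨ l = -(Complex.I * ν)) :
        l.re = 0 ∧ l ≠ 0 := by
      rcases h with rfl | rfl <;> simp [hν.ne']
    rcases mul_eq_zero.1 h6 with h | h
    · exact key hω₁ ((mul_eq_zero.1 h).imp sub_eq_zero.1 eq_neg_of_add_eq_zero_left)
    · exact key hω₂ ((mul_eq_zero.1 h).imp sub_eq_zero.1 eq_neg_of_add_eq_zero_left)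
  · set S := Submodule.span ℂ {v | ∃ l, IsLeafEigenvector X C z l v}
    have eig {l : ℂ} {v} (hv : v ∈ leafTangent C z) (h : M *ᵥ v = l • v) : v ∈ S := by
      by_cases h0 : v = 0
      · rw [h0]; exact S.zero_mem
      · exact Submodule.subset_span ⟨l, hv, h0, h⟩
    -- If `M² u = -ν² u`, then `u` is the average of `u ∓ (i / ν) M u`, eigenvectors for `± i ν`
    -- when nonzero.
    have half {ν : ℝ} (hν : 0 < ν) {u} (hu : u ∈ leafTangent C z)
        (h : M *ᵥ (M *ᵥ u) = (-(ν : ℂ) ^ 2) • u) : u ∈ S := by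
      have hν' : (ν : ℂ) ≠ 0 := by exact_mod_cast hν.ne'
      have h1 : u + (-(Complex.I / ν)) • (M *ᵥ u) ∈ S := by
        refine eig (l := Complex.I * ν) (hadd hu (hsmul _ (hinv _ hu))) ?_
        rw [mulVec_add, mulVec_smul, h, smul_add, smul_smul, smul_smul, add_comm]
        congr 2
        · field_simp
        · field_simp
          simp
      have h2 : u + (Complex.I / ν) • (M *ᵥ u) ∈ S := by
        refine eig (l := -(Complex.I * ν)) (hadd hu (hsmul _ (hinv _ hu))) ?_
        rw [mulVec_add, mulVec_smul, h, smul_add, smul_smul, smul_smul, add_comm]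
        congr 2
        · field_simp
        · field_simp
          simp
      have h3 := S.smul_mem (1 / 2 : ℂ) (S.add_mem h1 h2)
      convert h3 using 1
      ext i
      simp
      ring
    intro w hw
    have hne' : ((ω₁ : ℂ) ^ 2 - ω₂ ^ 2) ≠ 0 := by exact_mod_cast hne
    have hw2 := hinv _ (hinv _ hw)
    -- Each factor of the quartic maps `w` into the kernel of the other one; the difference of the
    -- two images is a nonzero multiple of `w`.
    have h1 : M *ᵥ (M *ᵥ w) + ((ω₂ : ℂ) ^ 2) • w ∈ S := by
      refine half hω₁ (hadd hw2 (hsmul _ hw)) ?_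
      simp only [mulVec_add, mulVec_smul, hq w hw]
      ext i
      simp
      ring
    have h2 : M *ᵥ (M *ᵥ w) + ((ω₁ : ℂ) ^ 2) • w ∈ S := by
      refine half hω₂ (hadd hw2 (hsmul _ hw)) ?_
      simp only [mulVec_add, mulVec_smul, hq w hw]
      ext i
      simp
      ring
    have h3 := S.smul_mem (((ω₁ : ℂ) ^ 2 - ω₂ ^ 2)⁻¹) (S.sub_mem h2 h1)
    convert h3 using 1
    ext i
    simp
    field_simp

theorem linearization_mulVec (X : Red → Red) (z : Red) (w : Fin 5 → ℂ) (i : Fin 5) :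
    (linearization X z *ᵥ w) i =
      (fderiv ℝ X z (fun j => (w j).re) i : ℂ) +
        Complex.I * (fderiv ℝ X z (fun j => (w j).im) i : ℂ) := by
  have h (v : Red) : fderiv ℝ X z v i = ∑ j, fderiv ℝ X z (Pi.single j 1) i * v j := by
    have := congrFun (LinearMap.toMatrix'_mulVec (fderiv ℝ X z : Red →ₗ[ℝ] Red) v) i
    rw [mulVec, dotProduct] at this
    simpa [LinearMap.toMatrix'_apply] using this.symm
  rw [h, h]
  simp only [linearization, mulVec, dotProduct, map_apply, LinearMap.toMatrix'_apply]
  push_cast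
  rw [Finset.mul_sum, ← Finset.sum_add_distrib]
  refine Finset.sum_congr rfl fun j _ => ?_
  have e := Complex.re_add_im (w j)
  linear_combination (-(fderiv ℝ X z (Pi.single j 1) i : ℂ)) * e

/-- The linearization of `X` at `z` on the level set of the Casimir function is off-diagonal:
it exchanges the variations of `(p, m₁)` with those of `q` and of the direction of `(m₂, m₃)`. -/
def HasLeafBlocks (X : Red → Red) (z : Red) (A B : Matrix (Fin 2) (Fin 2) ℝ) : Prop :=
  z 2 = 0 ∧ z 3 ≠ 0 ∧ ∀ a p m τ : ℝ, fderiv ℝ X z ![a, p, m, -z 4 * τ, z 3 * τ] =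
    ![A 0 0 * p + A 0 1 * m, B 0 0 * a + B 0 1 * τ, B 1 0 * a + B 1 1 * τ,
      -z 4 * (A 1 0 * p + A 1 1 * m), z 3 * (A 1 0 * p + A 1 1 * m)]

section Blocks

variable {X : Red → Red} {z : Red} {A B : Matrix (Fin 2) (Fin 2) ℝ}

theorem HasLeafBlocks.mulVec (h : HasLeafBlocks X z A B) (a p m τ : ℂ) :
    linearization X z *ᵥ ![a, p, m, -z 4 * τ, z 3 * τ] =
      ![A 0 0 * p + A 0 1 * m, B 0 0 * a + B 0 1 * τ, B 1 0 * a + B 1 1 * τ,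
        -z 4 * (A 1 0 * p + A 1 1 * m), z 3 * (A 1 0 * p + A 1 1 * m)] := by
  have hre : (fun j => (![a, p, m, -z 4 * τ, z 3 * τ] j).re) =
      ![a.re, p.re, m.re, -z 4 * τ.re, z 3 * τ.re] := by
    apply red_ext <;> simp
  have him : (fun j => (![a, p, m, -z 4 * τ, z 3 * τ] j).im) =
      ![a.im, p.im, m.im, -z 4 * τ.im, z 3 * τ.im] := by
    apply red_ext <;> simp
  ext i
  rw [linearization_mulVec, hre, him, h.2.2, h.2.2]
  fin_cases i <;> apply Complex.ext <;> simp

theorem HasLeafBlocks.mem_leafTangent_iff (h : HasLeafBlocks X z A B) (w : Fin 5 → ℂ) :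
    w ∈ leafTangent casimir z ↔ ∃ a p m τ : ℂ, w = ![a, p, m, -z 4 * τ, z 3 * τ] := by
  rw [leafTangent_casimir, mem_ofPred_eq, h.1]
  have h3 : (z 3 : ℂ) ≠ 0 := by exact_mod_cast h.2.1
  constructor
  · intro e
    refine ⟨w 0, w 1, w 2, w 4 / z 3, ?_⟩
    ext i
    fin_cases i
    · rfl
    · rfl
    · rfl
    · simp
      field_simp
      push_cast at e
      linear_combination e
    · simp
      field_simp
  · rintro ⟨a, p, m, τ, rfl⟩
    simp
    ring

/-- The square of the linearization acts as `A B` on the variations `(q, τ)` and as `B A` on `(p,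
m₁)`. These share trace and determinant, so Cayley-Hamilton supplies the quartic relation. -/
theorem HasLeafBlocks.isEllipticRE (h : HasLeafBlocks X z A B) (hX : X z = 0) {T D : ℝ}
    (hTe : T = (A * B).trace) (hDe : D = A.det * B.det) (hT : T < 0) (hD : 0 < D)
    (hTD : 4 * D < T ^ 2) : IsEllipticRE X casimir z := by
  refine isEllipticRE_of_quartic hX ?_ hT hD hTD ?_
  · intro w hw
    obtain ⟨a, p, m, τ, rfl⟩ := (h.mem_leafTangent_iff w).1 hw
    rw [h.mulVec, h.mem_leafTangent_iff]
    exact ⟨_, _, _, _, rfl⟩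
  · intro w hw
    obtain ⟨a, p, m, τ, rfl⟩ := (h.mem_leafTangent_iff w).1 hw
    rw [trace_fin_two, Matrix.mul_apply, Matrix.mul_apply, Fin.sum_univ_two, Fin.sum_univ_two]
      at hTe
    rw [det_fin_two, det_fin_two] at hDe
    simp only [h.mulVec]
    subst hTe hDe
    ext i
    fin_cases i <;> simp <;> ring

/-- The hypotheses say that the pure `τ` direction is an eigenvector of `A B` with positive
eigenvalue `l²`. Completing it by `B (0, 1) / l` in `(p, m₁)` gives an eigenvector for `l`. -/
theorem HasLeafBlocks.isUnstableRE (h : HasLeafBlocks X z A B) (hX : X z = 0)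
    (h0 : A 0 0 * B 0 1 + A 0 1 * B 1 1 = 0) (h1 : 0 < A 1 0 * B 0 1 + A 1 1 * B 1 1) :
    IsUnstableRE X casimir z := by
  obtain ⟨l, hl, hl2⟩ : ∃ l : ℝ, 0 < l ∧ l ^ 2 = A 1 0 * B 0 1 + A 1 1 * B 1 1 :=
    ⟨√_, sqrt_pos.2 h1, sq_sqrt h1.le⟩
  have hlc : (l : ℂ) ≠ 0 := by exact_mod_cast hl.ne'
  have h0c : (A 0 0 * B 0 1 + A 0 1 * B 1 1 : ℂ) = 0 := by exact_mod_cast h0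
  have hl2c : (l ^ 2 : ℂ) = A 1 0 * B 0 1 + A 1 1 * B 1 1 := by exact_mod_cast hl2
  refine ⟨hX, l, ![0, B 0 1 / l, B 1 1 / l, -z 4 * 1, z 3 * 1], ⟨?_, fun e => ?_, ?_⟩, by simpa⟩
  · exact (h.mem_leafTangent_iff _).2 ⟨_, _, _, _, rfl⟩
  · have := congrFun e 4
    simp [h.2.1] at this
  · rw [h.mulVec]
    have e : (A 1 0 * (B 0 1 / l) + A 1 1 * (B 1 1 / l) : ℂ) = l := by
      field_simp
      exact hl2c.symm
    rw [e]
    ext i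
    fin_cases i
    · simp
      field_simp
      rw [mul_zero]
      exact h0c
    · simp; field_simp
    · simp; field_simp
    · simp; ring
    · simp; ring

end Blocks

/-! ### The cotangent potential -/

theorem hasDerivAt_cot {q : ℝ} (hq : q ∈ Ioo 0 π) : HasDerivAt Real.cot (-1 / sin q ^ 2) q := by
  have : Real.cot = fun q => cos q / sin q := funext fun q => Real.cot_eq_cos_div_sin q
  rw [this]
  exact hasDerivAt_cos_div_sin (sin_pos_of_mem_Ioo hq).ne'

theorem deriv_cot {q : ℝ} (hq : q ∈ Ioo 0 π) : deriv Real.cot q = -1 / sin q ^ 2 :=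
  (hasDerivAt_cot hq).deriv

theorem deriv_cot_neg : ∀ q ∈ Ioo 0 π, deriv Real.cot q < 0 := fun q hq => by
  have := sin_pos_of_mem_Ioo hq
  rw [deriv_cot hq]
  exact div_neg_of_neg_of_pos (by norm_num) (by positivity)

theorem contDiffOn_cot : ContDiffOn ℝ ∞ Real.cot (Ioo 0 π) := by
  have : Real.cot = fun q => cos q / sin q := funext fun q => Real.cot_eq_cos_div_sin q
  rw [this]
  exact contDiff_cos.contDiffOn.div contDiff_sin.contDiffOn
    fun q hq => (sin_pos_of_mem_Ioo hq).ne'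

theorem deriv_deriv_cot {q : ℝ} (hq : q ∈ Ioo 0 π) :
    deriv (deriv Real.cot) q = 2 * cos q / sin q ^ 3 := by
  have hs := sin_pos_of_mem_Ioo hq
  have he : deriv Real.cot =ᶠ[𝓝 q] fun q => -1 / sin q ^ 2 :=
    eventually_of_mem (Ioo_mem_nhds hq.1 hq.2) fun q hq => deriv_cot hq
  rw [he.deriv_eq]
  refine (((hasDerivAt_const q (-1 : ℝ)).div ((hasDerivAt_sin q).pow 2)
    (pow_ne_zero 2 hs.ne')).congr_deriv ?_).deriv
  simp only [Pi.pow_apply]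
  field_simp
  norm_num
  ring

section Cot

variable {μ b : ℝ} {d : Rotation}

theorem IsBalanced.hasLeafBlocks_isosceles (hμ : 0 < μ)
    (h : IsBalanced (coupling μ Real.cot d.q) d (-b) b) :
    b ≠ 0 ∧ HasLeafBlocks (redField μ μ Real.cot) (d.reduced μ μ)
      !![2 / μ, -1 / μ; 1 / μ, -cos d.q / ((1 + cos d.q) * μ)]
      !![-2 * μ * b ^ 2, 2 * μ * b ^ 2 * (cos d.q * (1 + cos d.q));
        -2 * μ * b ^ 2 * (cos d.q * (1 + cos d.q)),
        4 * μ * b ^ 2 * (cos d.q * (1 + cos d.q))] := by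
  have hq := h.q_mem
  have hs := sin_pos_of_mem_Ioo hq
  have hsc := sin_sq_add_cos_sq d.q
  have hc := h.cos_mem
  have hc1 : 0 < 1 + cos d.q := by linarith [hc.1]
  have hb := (h.isosceles_angles (coupling_neg hμ deriv_cot_neg hq)).1
  have hb0 : b ≠ 0 := by
    rintro rfl
    have := coupling_neg hμ deriv_cot_neg hq
    linarith
  -- For the cotangent `-κ = 1 / (μ sin³ q)`, so the balance equation expresses the second
  -- derivative of the potential through `b`.
  have hdd : deriv (deriv Real.cot) d.q = 2 * cos d.q * (μ * (b ^ 2 * (1 - cos d.q))) := by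
    rw [deriv_deriv_cot hq, hb, coupling, deriv_cot hq]
    field_simp
  have e0 : d.reduced μ μ 0 = d.q := rfl
  have hr := h.reduced μ
  refine ⟨hb0, ?_, ?_, fun a p m τ => ?_⟩
  · rw [hr]; rfl
  · rw [hr]
    simp only [cons_val]
    have : b - -b * cos d.q = b * (1 + cos d.q) := by ring
    rw [this]
    positivity
  · rw [fderiv_redField hμ.ne' (e0 ▸ hq) contDiffOn_cot (by rw [hr]; rfl) (by rw [hr]; rfl), hr]
    simp only [cons_val, of_apply, hdd]
    generalize cos d.q = C at *
    generalize sin d.q = S at *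
    apply red_ext
    · simp only [cons_val]; ring
    · simp only [cons_val]
      field_simp
      grind
    · simp only [cons_val]
      field_simp
      grind
    · simp only [cons_val]
      field_simp
      grind
    · simp only [cons_val]
      field_simp
      grind

theorem isUnstableRE_isosceles (hμ : 0 < μ) (hd : IsIsoscelesRE μ Real.cot d)
    (hq : d.q ∈ Ioo 0 (π / 2)) :
    IsUnstableRE (redField μ μ Real.cot) casimir (d.reduced μ μ) := by
  obtain ⟨a, b, h⟩ := (isRE_iff_balanced hμ contDiffOn_cot deriv_cot_neg d).1 hd.1
  obtain rfl := h.axis_dot_sum_eq_zero_iff.1 hd.2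
  obtain ⟨hb, hL⟩ := h.hasLeafBlocks_isosceles hμ
  have hX := h.redField_reduced_eq_zero hμ (hasDerivAt_cot h.q_mem).differentiableAt rfl
  have hc : 0 < cos d.q := cos_pos_of_mem_Ioo ⟨by linarith [hq.1, pi_pos], hq.2⟩
  have hc1 : 0 < 1 - cos d.q := by linarith [h.cos_mem.2]
  refine hL.isUnstableRE hX ?_ ?_
  · simp; field_simp; norm_num
  · have : (0 : ℝ) < 2 * b ^ 2 * (cos d.q * (1 - cos d.q)) := by positivity
    convert this using 1
    simp
    field_simp
    ring

/-- With `c = cos q`, `A B` is triangular with diagonal entries `-2b² (1 - c) (2 + c)` and `2b² c (1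
- c)`. Both are negative exactly for `c < 0`, and `T² - 4D` is the square of their difference `4b²
(1 - c) (1 + c)`. -/
theorem isEllipticRE_isosceles (hμ : 0 < μ) (hd : IsIsoscelesRE μ Real.cot d)
    (hq : d.q ∈ Ioo (π / 2) π) :
    IsEllipticRE (redField μ μ Real.cot) casimir (d.reduced μ μ) := by
  obtain ⟨a, b, h⟩ := (isRE_iff_balanced hμ contDiffOn_cot deriv_cot_neg d).1 hd.1
  obtain rfl := h.axis_dot_sum_eq_zero_iff.1 hd.2
  obtain ⟨hb, hL⟩ := h.hasLeafBlocks_isosceles hμ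
  have hX := h.redField_reduced_eq_zero hμ (hasDerivAt_cot h.q_mem).differentiableAt rfl
  have hc : 0 < -cos d.q := by
    have := cos_neg_of_pi_div_two_lt_of_lt hq.1 (by linarith [hq.2, pi_pos])
    linarith
  have hc1 : 0 < 1 - cos d.q := by linarith [h.cos_mem.2]
  have hc2 : 0 < 1 + cos d.q := by linarith [h.cos_mem.1]
  have hc3 : 0 < 2 + cos d.q := by linarith [h.cos_mem.1]
  refine hL.isEllipticRE hX (T := -(4 * b ^ 2 * (1 - cos d.q)))
    (D := 4 * (b ^ 2) ^ 2 * (-cos d.q * (2 + cos d.q)) * (1 - cos d.q) ^ 2) ?_ ?_ ?_ ?_ ?_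
  · rw [trace_fin_two]
    simp [Matrix.mul_apply]
    field_simp
    ring
  · rw [det_fin_two, det_fin_two]
    simp
    field_simp
    ring
  · have : 0 < 4 * b ^ 2 * (1 - cos d.q) := by positivity
    linarith
  · positivity
  · have : 0 < 16 * (b ^ 2) ^ 2 * (1 - cos d.q) ^ 2 * (1 + cos d.q) ^ 2 := by positivity
    linarith

/-- The determinant `(b² - a²)²` degenerates only at the crossing `θ = π / 4`, and `T² - 4D = 16 a²
b²` is positive because `a b < 0`. -/
theorem isEllipticRE_rightAngled (hμ : 0 < μ) (hd : IsRightAngledRE μ Real.cot d)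
    (hθ : d.θ ≠ π / 4) : IsEllipticRE (redField μ μ Real.cot) casimir (d.reduced μ μ) := by
  obtain ⟨a, b, h⟩ := (isRE_iff_balanced hμ contDiffOn_cot deriv_cot_neg d).1 hd.1
  have hq := hd.2
  have hκ := coupling_neg hμ deriv_cot_neg h.q_mem
  have hX := h.redField_reduced_eq_zero hμ (hasDerivAt_cot h.q_mem).differentiableAt rfl
  have hab := h.mul_neg hκ
  have ha : a ≠ 0 := left_ne_zero_of_mul hab.ne
  have hb : b ≠ 0 := right_ne_zero_of_mul hab.ne
  have hne : b ^ 2 - a ^ 2 ≠ 0 := by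
    intro e
    rcases sq_eq_sq_iff_eq_or_eq_neg.1 (sub_eq_zero.1 e).symm with rfl | rfl
    · nlinarith
    · obtain ⟨-, e1, e2, -⟩ := h.isosceles_angles hκ
      apply hθ
      rw [Rotation.θ, e1, e2, hq, min_self]
      ring
  have hr : d.reduced μ μ = ![π / 2, 0, 0, μ * b, -(μ * a)] := by
    rw [h.reduced, hq]
    simp
  have hL : HasLeafBlocks (redField μ μ Real.cot) (d.reduced μ μ)
      !![2 / μ, -1 / μ; 1 / μ, 0]
      !![-2 * μ * a ^ 2, μ * (a ^ 2 - b ^ 2); μ * (b ^ 2 - a ^ 2), 0] := by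
    have e0 : d.reduced μ μ 0 = d.q := rfl
    refine ⟨by rw [hr]; rfl, ?_, fun a' p m τ => ?_⟩
    · rw [hr]; exact mul_ne_zero hμ.ne' hb
    · rw [fderiv_redField hμ.ne' (e0 ▸ h.q_mem) contDiffOn_cot (by rw [hr]; rfl)
        (by rw [hr]; rfl), hr]
      simp only [cons_val, of_apply, deriv_deriv_cot pi_div_two_mem, cos_pi_div_two,
        sin_pi_div_two]
      apply red_ext <;> simp only [cons_val] <;> field_simp <;> ring
  refine hL.isEllipticRE hX (T := -(2 * (a ^ 2 + b ^ 2))) (D := (b ^ 2 - a ^ 2) ^ 2) ?_ ?_ ?_ ?_ ?_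
  · rw [trace_fin_two]
    simp [Matrix.mul_apply]
    field_simp
    ring
  · rw [det_fin_two, det_fin_two]
    simp
    field_simp
    ring
  · have : 0 < 2 * (a ^ 2 + b ^ 2) := by positivity
    linarith
  · positivity
  · have : 0 < a ^ 2 * b ^ 2 := by positivity
    linarith

end Cot

end SphereTwoBody

theorem theorem1 (μ : ℝ) (hμ : 0 < μ) :
    (∀ V : ℝ → ℝ, ContDiffOn ℝ ∞ V (Ioo 0 π) → (∀ q ∈ Ioo 0 π, deriv V q < 0) →
      -- geometry and angular velocity of the relative equilibria; the two classes
      (∀ d : Rotation, IsRE μ μ V d →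
        d.SameSide ∧
        d.θ₁ ∈ Ioo 0 (π / 2) ∧ d.θ₂ ∈ Ioo 0 (π / 2) ∧ d.q = π - (d.θ₁ + d.θ₂) ∧
        μ / 2 * sin (2 * d.θ₁) = μ / 2 * sin (2 * d.θ₂) ∧
        d.Ω ⬝ᵥ d.Ω = -(μ / 2 * sin (2 * d.θ₁))⁻¹ * deriv V d.q ∧
        (IsIsoscelesRE μ V d ∨ IsRightAngledRE μ V d) ∧
        (IsRightAngledRE μ V d → d.θ ∈ Ioc 0 (π / 4)) ∧
        (IsIsoscelesRE μ V d ∧ IsRightAngledRE μ V d ↔ d.q = π / 2 ∧ d.θ = π / 4)) ∧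
      -- isosceles class
      (∀ q ∈ Ioo 0 π, q ≠ π / 2 →
        (∃ d, IsRE μ μ V d ∧ d.q = q) ∧
        (∀ d, IsRE μ μ V d → d.q = q → IsIsoscelesRE μ V d) ∧
        (∀ d d', IsRE μ μ V d → d.q = q → IsRE μ μ V d' → d'.q = q → RotCongruent d d')) ∧
      -- right-angled class
      (∀ θ ∈ Ioc 0 (π / 4),
        (∃ d, IsRightAngledRE μ V d ∧ d.θ = θ) ∧
        (∀ d d', IsRightAngledRE μ V d → d.θ = θ → IsRightAngledRE μ V d' → d'.θ = θ →
          RotCongruent d d' ∨ RotCongruent d.swap d')) ∧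
      -- the two families meet in a pitchfork bifurcation
      (∃ γ δ : ℝ → Red,
        (∀ s ∈ Ioo (-(π / 2)) (π / 2), ∃ d, IsIsoscelesRE μ V d ∧ d.q = π / 2 + s ∧
          γ s = d.reduced μ μ) ∧
        (∀ s ∈ Ioo (-(π / 4)) (π / 4), ∃ d, IsRightAngledRE μ V d ∧ d.θ = π / 4 - |s| ∧
          δ s = d.reduced μ μ) ∧
        IsSymmetricCrossing (redField μ μ V) casimir mirrorSwap γ δ ∧
        (IsPitchfork (redField μ μ V) casimir mirrorSwap γ δ ↔
          iteratedDeriv 2 V (π / 2) ≠ 2 * deriv V (π / 2)))) ∧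
    -- linear stability for the potential `cot q`
    (∀ d : Rotation,
      (IsIsoscelesRE μ Real.cot d → d.q ∈ Ioo 0 (π / 2) →
        IsUnstableRE (redField μ μ Real.cot) casimir (d.reduced μ μ)) ∧
      (IsIsoscelesRE μ Real.cot d → d.q ∈ Ioo (π / 2) π →
        IsEllipticRE (redField μ μ Real.cot) casimir (d.reduced μ μ)) ∧
      (IsRightAngledRE μ Real.cot d → d.θ ≠ π / 4 →
        IsEllipticRE (redField μ μ Real.cot) casimir (d.reduced μ μ))) := by
  refine ⟨fun V hV hV' => ⟨geometry_of_isRE hμ hV hV',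
    fun q hq hq2 => isosceles_class hμ hV hV' hq hq2,
    fun θ hθ => rightAngled_class hμ hV hV' hθ,
    isoscelesBranch μ V, rightAngledBranch μ V, fun s hs => ?_, fun s hs => ?_,
    isSymmetricCrossing_branches hμ hV hV', isPitchfork_branches_iff hμ hV hV'⟩,
    fun d => ⟨isUnstableRE_isosceles hμ, isEllipticRE_isosceles hμ, isEllipticRE_rightAngled hμ⟩⟩
  · have hq := pi_div_two_add_mem hs
    exact ⟨_, isIsoscelesRE_isoscelesRotation hμ hV hV' hq, isoscelesRotation_q hq _,
      (reduced_isoscelesRotation hμ hV' hs).symm⟩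
  · exact ⟨_, isRightAngledRE_rightAngledRotation hμ hV hV' hs,
      rightAngledRotation_θ (coupling_neg hμ hV' pi_div_two_mem) hs,
      (reduced_rightAngledRotation hμ hV' hs).symm⟩
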